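/- Let $\operatorname{Sym}_n^+$ be the set of real symmetric positive definite $n\times n$ matrices, an open subset of the space $\operatorname{Sym}_n$ of symmetric matrices, so that $T_{\mathbf P}\operatorname{Sym}_n^+=\operatorname{Sym}_n$. For a matrix $\mathbf Y$ let $\lfloor\mathbf Y\rfloor$ be its strictly lower triangular part, $\mathbb D(\mathbf Y)$ its diagonal part and $\mathbf Y_{1/2}=\lfloor\mathbf Y\rfloor+\tfrac12\mathbb D(\mathbf Y)$; for $\mathbf P\in\operatorname{Sym}_n^+$ let $\mathscr L(\mathbf P)$ be the Cholesky factor (lower triangular, positive diagonal, $\mathbf P=\mathscr L(\mathbf P)\mathscr L(\mathbf P)^T$). Let $g\in\{ai,le,lc\}$ denote one of the following Riemannian metrics on $\operatorname{Sym}_n^+$ with the accompanying operations $\oplus_g,\ominus_g$. * Affine-Invariant, with any parameter $\beta>-\frac1n$: $\langle\mathbf V,\mathbf W\rangle^{ai}_{\mathbf P}=\operatorname{Tr}(\mathbf V\mathbf P^{-1}\mathbf W\mathbf P^{-1})+\beta\operatorname{Tr}(\mathbf V\mathbf P^{-1})\operatorname{Tr}(\mathbf W\mathbf P^{-1})$;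 $\ \mathbf P\oplus_{ai}\mathbf Q=\mathbf P^{1/2}\mathbf Q\mathbf P^{1/2}$, $\ominus_{ai}\mathbf P=\mathbf P^{-1}$. * Log-Euclidean: $\langle\mathbf V,\mathbf W\rangle^{le}_{\mathbf P}=\operatorname{Tr}\big(D_{\mathbf P}\log[\mathbf V]\,D_{\mathbf P}\log[\mathbf W]\big)$; $\ \mathbf P\oplus_{le}\mathbf Q=\exp(\log\mathbf P+\log\mathbf Q)$, $\ominus_{le}\mathbf P=\mathbf P^{-1}$. * Log-Cholesky: with $\mathbf L=\mathscr L(\mathbf P)$, $\mathbf X=\mathbf L(\mathbf L^{-1}\mathbf V\mathbf L^{-T})_{1/2}$, $\mathbf Y=\mathbf L(\mathbf L^{-1}\mathbf W\mathbf L^{-T})_{1/2}$, $\langle\mathbf V,\mathbf W\rangle^{lc}_{\mathbf P}=\sum_{i>j}\mathbf X_{ij}\mathbf Y_{ij}+\sum_j\mathbf X_{jj}\mathbf Y_{jj}\mathbf L_{jj}^{-2}$; $\ \mathbf P\oplus_{lc}\mathbf Q=\mathbf A\mathbf A^T$ with $\mathbf A=\lfloor\mathscr L(\mathbf P)\rfloor+\lfloor\mathscr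 L(\mathbf Q)\rfloor+\mathbb D(\mathscr L(\mathbf P))\mathbb D(\mathscr L(\mathbf Q))$, and $\ominus_{lc}\mathbf P=\mathbf B\mathbf B^T$ with $\mathbf B=-\lfloor\mathscr L(\mathbf P)\rfloor+\mathbb D(\mathscr L(\mathbf P))^{-1}$. Let $\operatorname{Exp}^g_{\mathbf P}$ be the Riemannian exponential map of $g$ at $\mathbf P$, $\operatorname{Log}^g_{\mathbf P}$ its inverse (the logarithmic map), and $\mathcal T^g_{\mathbf P\to\mathbf Q}$ the Levi-Civita parallel transport along the geodesic from $\mathbf P$ to $\mathbf Q$. The SPD inner product of $\mathbf P,\mathbf Q\in\operatorname{Sym}_n^+$ is $\langle\mathbf P,\mathbf Q\rangle^g=\langle\operatorname{Log}^g_{\mathbf I_n}(\mathbf P),\operatorname{Log}^g_{\mathbf I_n}(\mathbf Q)\rangle^g_{\mathbf I_n}$, and for $\mathbf P\in\operatorname{Sym}_n^+$, $\mathbf W\in T_{\mathbf P}\operatorname{Sym}_n^+$ the SPD hypergyroplane is $$\mathcal H^{spd,g}_{\mathbf W,\mathbf P}=\{\mathbf Q\in\operatorname{Sym}_n^+:\langle\operatorname{Log}^g_{\mathbf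 P}(\mathbf Q),\mathbf W\rangle^g_{\mathbf P}=0\}.$$ **Proposition.** For each $g\in\{ai,le,lc\}$, every $\mathbf P\in\operatorname{Sym}_n^+$ and every $\mathbf W\in T_{\mathbf P}\operatorname{Sym}_n^+$, $$\mathcal H^{spd,g}_{\mathbf W,\mathbf P}=\{\mathbf Q\in\operatorname{Sym}_n^+:\langle\ominus_g\mathbf P\oplus_g\mathbf Q,\ \operatorname{Exp}^g_{\mathbf I_n}(\mathcal T^g_{\mathbf P\to\mathbf I_n}(\mathbf W))\rangle^g=0\}.$$ -/

import Mathlib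

namespace SPDGyro

/-- Real `n × n` matrices. -/
abbrev Mat (n : ℕ) := Matrix (Fin n) (Fin n) ℝ

/-! ### Matrix functions on symmetric positive definite matrices -/

/-- Matrix logarithm of a symmetric positive definite matrix (spectral calculus). -/
noncomputable def matLog {n : ℕ} (P : Mat n) : Mat n := cfc Real.log P

/-- Positive square root of a symmetric positive definite matrix (spectral calculus). -/
noncomputable def matSqrt {n : ℕ} (P : Mat n) : Mat n := cfc Real.sqrt P

/-- Strictly lower triangular part. -/
def strictLower {n : ℕ} (Y : Mat n) : Mat n :=
  Matrix.of fun i j => if j < i then Y i j else 0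

/-- Diagonal part. -/
def diagPart {n : ℕ} (Y : Mat n) : Mat n := Matrix.diagonal fun i => Y i i

/-- `L` is a Cholesky factor of `P`: lower triangular, positive diagonal, `P = L Lᵀ`. -/
def IsCholesky {n : ℕ} (P L : Mat n) : Prop :=
  (∀ i j, i < j → L i j = 0) ∧ (∀ i, 0 < L i i) ∧ P = L * L.transpose

/-- The (unique) Cholesky factor of a symmetric positive definite matrix. -/
noncomputable def cholesky {n : ℕ} (P : Mat n) : Mat n :=
  Classical.epsilon fun L => IsCholesky P L

/-! ### The three families of Riemannian metrics

Symmetric positive definite matrices form an open subset of the space of symmetric matrices,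
so the tangent space at each point is the space of symmetric matrices. A Riemannian metric is
given by `G P V W`, for `P` positive definite and `V`, `W` symmetric; values of `G` at other
arguments are never used. -/

/-- The affine-invariant metric with parameter `β`:
`Tr (V P⁻¹ W P⁻¹) + β Tr (V P⁻¹) Tr (W P⁻¹)`. -/
noncomputable def aiMetric {n : ℕ} (β : ℝ) (P V W : Mat n) : ℝ :=
  (V * P⁻¹ * W * P⁻¹).trace + β * (V * P⁻¹).trace * (W * P⁻¹).trace

/-- Differential of the matrix logarithm at `P` in the direction `V`. -/
noncomputable def dLog {n : ℕ} (P V : Mat n) : Mat n :=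
  deriv (fun s : ℝ => matLog (P + s • V)) 0

/-- The log-Euclidean metric: the pull-back of the Frobenius inner product by the logarithm. -/
noncomputable def leMetric {n : ℕ} (P V W : Mat n) : ℝ :=
  (dLog P V * dLog P W).trace

/-- `S ↦ (S)_{1/2}`: strictly lower triangular part plus half of the diagonal part. -/
noncomputable def halfLower {n : ℕ} (S : Mat n) : Mat n :=
  strictLower S + (1 / 2 : ℝ) • diagPart S

/-- Differential at `P` of the Cholesky map `P ↦ L`: `W ↦ L (L⁻¹ W L⁻ᵀ)_{1/2}`. -/
noncomputable def dCholesky {n : ℕ} (P W : Mat n) : Mat n :=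
  cholesky P * halfLower ((cholesky P)⁻¹ * W * ((cholesky P)⁻¹).transpose)

/-- The log-Cholesky metric: the pull-back by the Cholesky map of the metric
`∑_{i > j} X i j * Y i j + ∑ j, X j j * Y j j / (L j j) ^ 2` at `L` on lower triangular
matrices with positive diagonal. -/
noncomputable def lcMetric {n : ℕ} (P V W : Mat n) : ℝ :=
  (strictLower (dCholesky P V) * (strictLower (dCholesky P W)).transpose).trace
    + ∑ j, dCholesky P V j j * dCholesky P W j j / (cholesky P j j) ^ 2

/-! ### Riemannian notions on the open set of positive definite matrices -/

/-- Derivative of the coefficient `P ↦ G P V W` in the direction `Z`. -/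
noncomputable def metricDeriv {n : ℕ} (G : Mat n → Mat n → Mat n → ℝ)
    (P Z V W : Mat n) : ℝ :=
  deriv (fun s : ℝ => G (P + s • Z) V W) 0

/-- `V` is a parallel vector field along the curve `γ` for the Levi-Civita connection of `G`.
The equation says that `G (∇_{γ'} V, W) = 0` for every tangent vector `W`, where
`∇_{γ'} V = V' + Γ(γ', V)` and the Christoffel term is
`G (Γ(Z, V), W) = ½ (∂_Z G (V, W) + ∂_V G (Z, W) - ∂_W G (Z, V))`. -/
structure IsParallelAlong {n : ℕ} (G : Mat n → Mat n → Mat n → ℝ)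
    (γ V : ℝ → Mat n) : Prop where
  isSymm : ∀ t, (V t).IsSymm
  differentiable : ∀ t, DifferentiableAt ℝ V t
  equation : ∀ t, ∀ W : Mat n, W.IsSymm →
    G (γ t) (deriv V t) W
      + 1 / 2 * (metricDeriv G (γ t) (deriv γ t) (V t) W
          + metricDeriv G (γ t) (V t) (deriv γ t) W
          - metricDeriv G (γ t) W (deriv γ t) (V t)) = 0

/-- `γ` is a geodesic of `G` defined for all times (the metrics considered are complete). -/
structure IsGeodesic {n : ℕ} (G : Mat n → Mat n → Mat n → ℝ) (γ : ℝ → Mat n) : Prop where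
  posDef : ∀ t, (γ t).PosDef
  differentiable : ∀ t, DifferentiableAt ℝ γ t
  parallel : IsParallelAlong G γ (deriv γ)

/-- Riemannian exponential map: the value at time `1` of the geodesic starting at `P` with
velocity `W`. -/
noncomputable def expMap {n : ℕ} (G : Mat n → Mat n → Mat n → ℝ) (P W : Mat n) : Mat n :=
  Classical.epsilon fun Q => ∃ γ, IsGeodesic G γ ∧ γ 0 = P ∧ deriv γ 0 = W ∧ γ 1 = Q

/-- Riemannian logarithmic map: the tangent vector at `P` sent to `Q` by the exponential map
(for the metrics considered, the exponential map at each point is a bijection). -/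
noncomputable def logMap {n : ℕ} (G : Mat n → Mat n → Mat n → ℝ) (P Q : Mat n) : Mat n :=
  Classical.epsilon fun W => W.IsSymm ∧ expMap G P W = Q

/-- Parallel transport of `W` from `P` to `Q` along the geodesic joining `P` to `Q`. -/
noncomputable def transport {n : ℕ} (G : Mat n → Mat n → Mat n → ℝ) (P Q W : Mat n) : Mat n :=
  Classical.epsilon fun X => ∃ γ V, IsGeodesic G γ ∧ γ 0 = P ∧ γ 1 = Q ∧
    IsParallelAlong G γ V ∧ V 0 = W ∧ V 1 = X

/-! ### The three geometries and their gyrovector space operations -/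

/-- The affine-invariant (one for each `β > -1/n`), log-Euclidean and log-Cholesky geometries. -/
inductive Geometry (n : ℕ) where
  | ai (β : ℝ) (hβ : -1 / (n : ℝ) < β) : Geometry n
  | le : Geometry n
  | lc : Geometry n

/-- The Riemannian metric `⟨V, W⟩_P` of a geometry, as a function of `P`, `V`, `W`. -/
noncomputable def Geometry.metric {n : ℕ} : Geometry n → Mat n → Mat n → Mat n → ℝ
  | .ai β _ => aiMetric β
  | .le => leMetric
  | .lc => lcMetric

/-- Lower triangular factor of the log-Cholesky sum:
`⌊L(P)⌋ + ⌊L(Q)⌋ + D(L(P)) D(L(Q))`. -/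
noncomputable def lcAddFactor {n : ℕ} (P Q : Mat n) : Mat n :=
  strictLower (cholesky P) + strictLower (cholesky Q)
    + diagPart (cholesky P) * diagPart (cholesky Q)

/-- Lower triangular factor of the log-Cholesky inverse: `-⌊L(P)⌋ + D(L(P))⁻¹`. -/
noncomputable def lcNegFactor {n : ℕ} (P : Mat n) : Mat n :=
  -strictLower (cholesky P) + (diagPart (cholesky P))⁻¹

/-- The binary operation `P ⊕_g Q`. -/
noncomputable def Geometry.add {n : ℕ} : Geometry n → Mat n → Mat n → Mat n
  | .ai _ _, P, Q => matSqrt P * Q * matSqrt P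
  | .le, P, Q => NormedSpace.exp (matLog P + matLog Q)
  | .lc, P, Q => lcAddFactor P Q * (lcAddFactor P Q).transpose

/-- The inverse operation `⊖_g P`. -/
noncomputable def Geometry.neg {n : ℕ} : Geometry n → Mat n → Mat n
  | .ai _ _, P => P⁻¹
  | .le, P => P⁻¹
  | .lc, P => lcNegFactor P * (lcNegFactor P).transpose

/-- The SPD inner product `⟨P, Q⟩^g = ⟨Log_I P, Log_I Q⟩_I`. -/
noncomputable def Geometry.spdInner {n : ℕ} (g : Geometry n) (P Q : Mat n) : ℝ :=
  g.metric 1 (logMap g.metric 1 P) (logMap g.metric 1 Q)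

/-- The SPD hypergyroplane `{Q : ⟨Log_P Q, W⟩_P = 0}`. -/
def Geometry.hypergyroplane {n : ℕ} (g : Geometry n) (W P : Mat n) : Set (Mat n) :=
  {Q | Q.PosDef ∧ g.metric P (logMap g.metric P Q) W = 0}

end SPDGyro

namespace SPDGyro

open scoped Matrix Matrix.Norms.L2Operator MatrixOrder Topology
open NormedSpace (exp)

variable {n : ℕ}

/-! ### Positive definite matrices, exponential and logarithm -/

/-! The two defining functions of `Q` are equal, not merely their zero sets. Parallel transport
along the geodesic from `P` to `1` is an isometry, so `⟨Log_P Q, W⟩_P = ⟨T Log_P Q, T W⟩_1`. In each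
geometry `T Log_P Q = Log_1 (⊖P ⊕ Q)`, and `T W = Log_1 (Exp_1 (T W))`.

Exponential, logarithm and transport are chosen by `Classical.epsilon` from differential conditions,
so geodesics and parallel fields have to be constructed and their endpoint values shown to be
determined.

Affine-invariant case: nondegeneracy turns the weak Levi-Civita equation into `V' = (V γ⁻¹ γ' + γ'
γ⁻¹ V) / 2`. Along a geodesic `A = γ⁻¹ γ'` is constant, so parallel fields are `Eᵀ V₀ E` with `E =
exp (t A / 2)`. With `R = P^{1/2}` this gives `Log_P Q = R log (R⁻¹ Q R⁻¹) R` and `T W = R⁻¹ W R⁻¹`,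
and invariance under congruence concludes (`hypergyroplane_ai`).

The other two metrics are Euclidean in a global chart (`FlatChart`): the matrix logarithm, or the
Cholesky factor with logarithms on the diagonal. There geodesics are affine, parallel fields have
constant coordinates and `⊖P ⊕ Q` is a difference of coordinates, so both functions are the same
constant form (`FlatChart.hypergyroplane`). -/

theorem epsilon_eq_of_unique {α : Type*} [Nonempty α] {p : α → Prop} {a : α} (h : p a)
    (hu : ∀ b, p b → b = a) : Classical.epsilon p = a :=
  hu _ (Classical.epsilon_spec ⟨a, h⟩)

theorem isHermitian_iff_isSymm {S : Mat n} : S.IsHermitian ↔ S.IsSymm := by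
  rw [Matrix.IsHermitian, Matrix.conjTranspose_eq_transpose_of_trivial, Matrix.IsSymm]

theorem isSymm_of_posDef {P : Mat n} (hP : P.PosDef) : P.IsSymm :=
  isHermitian_iff_isSymm.1 hP.isHermitian

theorem isSelfAdjoint_of_isSymm {S : Mat n} (hS : S.IsSymm) : IsSelfAdjoint S :=
  isHermitian_iff_isSymm.2 hS

theorem isUnit_det_of_posDef {P : Mat n} (hP : P.PosDef) : IsUnit P.det :=
  (Matrix.isUnit_iff_isUnit_det P).1 hP.isUnit

/-- Congruence by an invertible matrix preserves positive definiteness. -/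
theorem posDef_transpose_mul_mul {P E : Mat n} (hP : P.PosDef) (hE : IsUnit E) :
    (Eᵀ * P * E).PosDef := by
  have := (Matrix.IsUnit.posDef_star_left_conjugate_iff (x := P) hE).2 hP
  rwa [Matrix.star_eq_conjTranspose, Matrix.conjTranspose_eq_transpose_of_trivial] at this

theorem isUnit_exp (A : Mat n) : IsUnit (exp A) := Matrix.isUnit_exp A

theorem exp_half_mul_self (S : Mat n) :
    exp ((1 / 2 : ℝ) • S) * exp ((1 / 2 : ℝ) • S) = exp S := by
  rw [← Matrix.exp_add_of_commute _ _ (Commute.refl _), ← add_smul]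
  norm_num

theorem isSymm_exp_half {S : Mat n} (hS : S.IsSymm) : (exp ((1 / 2 : ℝ) • S)).IsSymm :=
  (hS.smul _).exp

theorem posDef_exp {S : Mat n} (hS : S.IsSymm) : (exp S).PosDef := by
  have := posDef_transpose_mul_mul (Matrix.PosDef.one (n := Fin n) (R := ℝ))
    (isUnit_exp ((1 / 2 : ℝ) • S))
  rwa [(isSymm_exp_half hS).eq, mul_one, exp_half_mul_self] at this

theorem matLog_exp {S : Mat n} (hS : S.IsSymm) : matLog (exp S) = S :=
  CFC.log_exp S (isSelfAdjoint_of_isSymm hS)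

theorem exp_matLog {P : Mat n} (hP : P.PosDef) : exp (matLog P) = P :=
  CFC.exp_log P hP.isStrictlyPositive

theorem isSymm_matLog (P : Mat n) : (matLog P).IsSymm :=
  isHermitian_iff_isSymm.1 (IsSelfAdjoint.log (a := P))

theorem matLog_inv {P : Mat n} (hP : P.PosDef) : matLog P⁻¹ = -matLog P := by
  conv_lhs => rw [← exp_matLog hP, ← Matrix.exp_neg]
  exact matLog_exp (isSymm_matLog P).neg

theorem matLog_one : matLog (1 : Mat n) = 0 := CFC.log_one

/-- The exponential is a nonnegative matrix with square `P⁻¹`. Functional calculus composes `sqrt`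
with squaring, which is the identity on a nonnegative spectrum. -/
theorem matSqrt_inv {P : Mat n} (hP : P.PosDef) :
    matSqrt P⁻¹ = exp ((1 / 2 : ℝ) • -matLog P) := by
  set E := exp ((1 / 2 : ℝ) • -matLog P) with hE
  have hEE : E * E = P⁻¹ := by
    rw [hE, exp_half_mul_self, Matrix.exp_neg, exp_matLog hP]
  have hE0 : 0 ≤ E := (posDef_exp ((isSymm_matLog P).neg.smul _)).posSemidef.nonneg
  rw [← hEE]
  have hsa : IsSelfAdjoint E := IsSelfAdjoint.of_nonneg hE0
  have h1 : E * E = cfc (fun x : ℝ => x ^ 2) E := by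
    rw [cfc_pow_id (R := ℝ) E 2, sq]
  rw [matSqrt, h1, ← cfc_comp Real.sqrt (fun x : ℝ => x ^ 2) E]
  conv_rhs => rw [← cfc_id ℝ E]
  refine cfc_congr fun x hx => ?_
  have := spectrum_nonneg_of_nonneg hE0 hx
  simp [Function.comp, Real.sqrt_sq this]

/-! ### Calculus of matrix curves -/

theorem hasDerivAt_clm {F : Type*} [NormedAddCommGroup F] [NormedSpace ℝ F] {γ : ℝ → Mat n}
    {γ' : Mat n} {t : ℝ} (L : Mat n →ₗ[ℝ] F) (h : HasDerivAt γ γ' t) :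
    HasDerivAt (fun s => L (γ s)) (L γ') t :=
  (L.toContinuousLinearMap.hasFDerivAt (x := γ t)).comp_hasDerivAt t h

theorem hasDerivAt_transpose {γ : ℝ → Mat n} {γ' : Mat n} {t : ℝ} (h : HasDerivAt γ γ' t) :
    HasDerivAt (fun s => (γ s)ᵀ) γ'ᵀ t :=
  hasDerivAt_clm (Matrix.transposeLinearEquiv (Fin n) (Fin n) ℝ ℝ).toLinearMap h

theorem hasDerivAt_trace {γ : ℝ → Mat n} {γ' : Mat n} {t : ℝ} (h : HasDerivAt γ γ' t) :
    HasDerivAt (fun s => (γ s).trace) γ'.trace t :=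
  hasDerivAt_clm (Matrix.traceLinearMap (Fin n) ℝ ℝ) h

theorem isSymm_deriv {γ : ℝ → Mat n} {t : ℝ} (hs : ∀ t, (γ t).IsSymm)
    (hd : DifferentiableAt ℝ γ t) : (deriv γ t).IsSymm := by
  have h := hasDerivAt_transpose hd.hasDerivAt
  simp only [(hs _).eq] at h
  exact h.unique hd.hasDerivAt

theorem hasDerivAt_inv {γ : ℝ → Mat n} {γ' : Mat n} {t : ℝ} (h : HasDerivAt γ γ' t)
    (hu : IsUnit (γ t)) : HasDerivAt (fun s => (γ s)⁻¹) (-((γ t)⁻¹ * γ' * (γ t)⁻¹)) t := by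
  obtain ⟨u, hu⟩ := hu
  have h1 := hasFDerivAt_ringInverse (𝕜 := ℝ) u
  have hf : (fun s => (γ s)⁻¹) = Ring.inverse ∘ γ := by
    ext1 s
    simp [Matrix.nonsing_inv_eq_ringInverse]
  rw [hf]
  rw [hu] at h1
  have h2 := h1.comp_hasDerivAt t h
  have hi : (γ t)⁻¹ = (↑u⁻¹ : Mat n) := by rw [← hu, Matrix.coe_units_inv]
  rw [hi]
  simpa [ContinuousLinearMap.mulLeftRight_apply] using h2

theorem hasDerivAt_line (P Z : Mat n) : HasDerivAt (fun s : ℝ => P + s • Z) Z 0 := by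
  simpa using ((hasDerivAt_id (0 : ℝ)).smul_const Z).const_add P

theorem eq_of_hasDerivAt_zero {F : Type*} [NormedAddCommGroup F] [NormedSpace ℝ F] {f : ℝ → F}
    (h : ∀ t, HasDerivAt f 0 t) (t : ℝ) : f t = f 0 :=
  is_const_of_deriv_eq_zero (fun t => (h t).differentiableAt) (fun t => (h t).deriv) t 0

/-! ### The affine-invariant geometry -/

/-- The pairing of `X` with `P` in the metric is `(1 + β n) Tr (X P⁻¹)`, so this factor decides
nondegeneracy. For `n = 0` it equals `1`. -/
theorem one_add_mul_pos {β : ℝ} (hβ : -1 / (n : ℝ) < β) : 0 < 1 + β * n := by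
  rcases Nat.eq_zero_or_pos n with rfl | hn
  · simp
  · have hn' : (0 : ℝ) < n := by exact_mod_cast hn
    rw [div_lt_iff₀ hn'] at hβ
    linarith

/-- A symmetric invertible square root of a positive definite matrix. -/
theorem exists_sqrt {P : Mat n} (hP : P.PosDef) :
    ∃ R : Mat n, R.IsSymm ∧ IsUnit R ∧ R * R = P :=
  ⟨exp ((1 / 2 : ℝ) • matLog P), isSymm_exp_half (isSymm_matLog P), isUnit_exp _, by
    rw [exp_half_mul_self, exp_matLog hP]⟩

/-- Testing against `P` forces `Tr (X P⁻¹) = 0`, which removes the `β` term. Testing against `X`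
then leaves the squared Frobenius norm of `C X C` with `C² = P⁻¹`. -/
theorem aiMetric_nondegenerate {β : ℝ} (hβ : -1 / (n : ℝ) < β) {P X : Mat n} (hP : P.PosDef)
    (hX : X.IsSymm) (h : ∀ W : Mat n, W.IsSymm → aiMetric β P X W = 0) : X = 0 := by
  have hdet := isUnit_det_of_posDef hP
  have h1 := h P (isSymm_of_posDef hP)
  have h2 := h X hX
  simp only [aiMetric, Matrix.mul_assoc, Matrix.mul_nonsing_inv P hdet, Matrix.mul_one,
    Matrix.trace_one, Fintype.card_fin] at h1
  have htr : (X * P⁻¹).trace = 0 := by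
    have : (X * P⁻¹).trace * (1 + β * n) = 0 := by linarith
    exact (mul_eq_zero.1 this).resolve_right (one_add_mul_pos hβ).ne'
  rw [aiMetric, htr, mul_zero, add_zero] at h2
  obtain ⟨C, hCs, hCu, hC⟩ := exists_sqrt hP.inv
  have hY : ((C * X * C)ᴴ * (C * X * C)).trace = 0 := by
    rw [Matrix.conjTranspose_eq_transpose_of_trivial]
    simp only [Matrix.transpose_mul, hCs.eq, hX.eq]
    rw [← h2, ← hC, Matrix.mul_assoc C, Matrix.mul_assoc C, Matrix.trace_mul_comm C]
    simp only [Matrix.mul_assoc]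
  rw [Matrix.trace_conjTranspose_mul_self_eq_zero_iff] at hY
  rw [hCu.mul_left_eq_zero] at hY
  exact (hCu.mul_right_eq_zero).1 hY

theorem metricDeriv_aiMetric (β : ℝ) {P : Mat n} (hP : P.PosDef) (Z V W : Mat n) :
    metricDeriv (aiMetric β) P Z V W =
      -(V * P⁻¹ * Z * P⁻¹ * W * P⁻¹).trace - (V * P⁻¹ * W * P⁻¹ * Z * P⁻¹).trace
        - β * ((V * P⁻¹ * Z * P⁻¹).trace * (W * P⁻¹).trace
          + (V * P⁻¹).trace * (W * P⁻¹ * Z * P⁻¹).trace) := by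
  have hu : IsUnit (P + (0 : ℝ) • Z) := by simpa using hP.isUnit
  have hI := hasDerivAt_inv (hasDerivAt_line P Z) hu
  have hV := hI.const_mul V
  have hW := hI.const_mul W
  have hVW := hV.mul hW
  have h := (hasDerivAt_trace hVW).add
    (((hasDerivAt_trace hV).const_mul β).mul (hasDerivAt_trace hW))
  have he : (fun s : ℝ => aiMetric β (P + s • Z) V W) =
      fun s => (V * (P + s • Z)⁻¹ * (W * (P + s • Z)⁻¹)).trace +
        β * (V * (P + s • Z)⁻¹).trace * (W * (P + s • Z)⁻¹).trace := by
    ext1 s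
    simp only [aiMetric, Matrix.mul_assoc]
  rw [metricDeriv, he]
  refine h.deriv.trans ?_
  simp only [zero_smul, add_zero, Matrix.mul_neg, Matrix.neg_mul, Matrix.trace_neg,
    Matrix.trace_add, Matrix.mul_assoc]
  ring

/-- The covariant derivative of the affine-invariant metric. -/
theorem aiMetric_christoffel (β : ℝ) {P : Mat n} (hP : P.PosDef) (Z V X W : Mat n) :
    aiMetric β P X W + 1 / 2 * (metricDeriv (aiMetric β) P Z V W
      + metricDeriv (aiMetric β) P V Z W - metricDeriv (aiMetric β) P W Z V) =
    aiMetric β P (X - (1 / 2 : ℝ) • (V * P⁻¹ * Z + Z * P⁻¹ * V)) W := by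
  simp only [metricDeriv_aiMetric β hP, aiMetric]
  set I := P⁻¹
  -- Up to cyclic rotation only two cubic traces occur, `V Z W` and `Z V W`. Each appears once in
  -- every metric derivative, so one copy of each survives the signed sum.
  have e1 : (Z * I * V * I * W * I).trace = (V * I * W * I * Z * I).trace := by
    rw [show Z * I * V * I * W * I = (Z * I) * (V * I * W * I) by simp only [Matrix.mul_assoc],
      Matrix.trace_mul_comm]
    simp only [Matrix.mul_assoc]
  have e2 : (V * I * Z * I * W * I).trace = (Z * I * W * I * V * I).trace := by
    rw [show V * I * Z * I * W * I = (V * I) * (Z * I * W * I) by simp only [Matrix.mul_assoc],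
      Matrix.trace_mul_comm]
    simp only [Matrix.mul_assoc]
  have cyc : ∀ A B : Mat n, (A * I * B * I).trace = (B * I * A * I).trace := fun A B => by
    rw [show A * I * B * I = (A * I) * (B * I) by simp only [Matrix.mul_assoc],
      Matrix.trace_mul_comm]
    simp only [Matrix.mul_assoc]
  simp only [Matrix.sub_mul, Matrix.smul_mul, Matrix.add_mul, Matrix.trace_sub,
    Matrix.trace_smul, Matrix.trace_add, smul_eq_mul]
  rw [e1, e2, cyc W Z, cyc Z V, cyc W V]
  ring

/-- Nondegeneracy removes the test vector `W` and leaves a linear equation for `V`. It applies only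
to symmetric matrices, hence the symmetry check on the covariant derivative. -/
theorem isParallelAlong_aiMetric_iff {β : ℝ} (hβ : -1 / (n : ℝ) < β) {γ V : ℝ → Mat n}
    (hγ : ∀ t, (γ t).PosDef) (hd : ∀ t, DifferentiableAt ℝ γ t) :
    IsParallelAlong (aiMetric β) γ V ↔ (∀ t, (V t).IsSymm) ∧ ∀ t, HasDerivAt V
      ((1 / 2 : ℝ) • (V t * (γ t)⁻¹ * deriv γ t + deriv γ t * (γ t)⁻¹ * V t)) t := by
  have hγs : ∀ t, (γ t).IsSymm := fun t => isSymm_of_posDef (hγ t)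
  constructor
  · rintro ⟨hs, hVd, he⟩
    refine ⟨hs, fun t => ?_⟩
    have hX : deriv V t -
        (1 / 2 : ℝ) • (V t * (γ t)⁻¹ * deriv γ t + deriv γ t * (γ t)⁻¹ * V t) = 0 := by
      refine aiMetric_nondegenerate hβ (hγ t) ?_ fun W hW => ?_
      · have h1 := isSymm_deriv hs (hVd t)
        have h2 := isSymm_deriv hγs (hd t)
        have h3 := isSymm_of_posDef (hγ t).inv
        refine h1.sub (Matrix.IsSymm.smul ?_ _)
        rw [Matrix.IsSymm, Matrix.transpose_add]
        simp only [Matrix.transpose_mul, h2.eq, h3.eq, (hs t).eq]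
        rw [add_comm]
        simp only [Matrix.mul_assoc]
      · rw [← aiMetric_christoffel β (hγ t)]
        exact he t W hW
    rw [← sub_eq_zero.1 hX]
    exact (hVd t).hasDerivAt
  · rintro ⟨hs, h⟩
    refine ⟨hs, fun t => (h t).differentiableAt, fun t W _ => ?_⟩
    rw [aiMetric_christoffel β (hγ t), (h t).deriv, sub_self]
    simp [aiMetric]

/-- The propagator `exp (t A / 2)` of the linear equation `2 V' = Aᵀ V + V A`. -/
noncomputable def aiProp (A : Mat n) (t : ℝ) : Mat n := exp (t • ((1 / 2 : ℝ) • A))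

theorem hasDerivAt_aiProp (A : Mat n) (t : ℝ) :
    HasDerivAt (aiProp A) (aiProp A t * ((1 / 2 : ℝ) • A)) t :=
  hasDerivAt_exp_smul_const (𝕂 := ℝ) _ t

theorem aiProp_comm (A : Mat n) (t : ℝ) : aiProp A t * A = A * aiProp A t := by
  have : Commute A (t • ((1 / 2 : ℝ) • A)) := ((Commute.refl A).smul_right _).smul_right _
  exact (this.exp_right).eq.symm

theorem aiProp_zero (A : Mat n) : aiProp A 0 = 1 := by simp [aiProp]

theorem aiProp_neg_mul (A : Mat n) (t : ℝ) : aiProp (-A) t * aiProp A t = 1 := by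
  rw [aiProp, smul_neg, smul_neg, Matrix.exp_neg, aiProp]
  exact Matrix.nonsing_inv_mul _ ((Matrix.isUnit_iff_isUnit_det _).1 (isUnit_exp _))

theorem hasDerivAt_aiProp_conj (A U : Mat n) (t : ℝ) :
    HasDerivAt (fun s => (aiProp A s)ᵀ * U * aiProp A s)
      ((1 / 2 : ℝ) • ((aiProp A t)ᵀ * U * aiProp A t * A +
        Aᵀ * ((aiProp A t)ᵀ * U * aiProp A t))) t := by
  have h := hasDerivAt_aiProp A t
  have h1 := ((hasDerivAt_transpose h).mul_const U).mul h
  refine h1.congr_deriv ?_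
  simp only [Matrix.mul_smul, Matrix.transpose_smul, Matrix.smul_mul, Matrix.transpose_mul,
    smul_add, Matrix.mul_assoc]
  rw [add_comm]

/-- Uniqueness without an ODE theorem: conjugating `V` by the inverse propagator `aiProp (-A)` gives
a curve with zero derivative. -/
theorem eq_aiProp_conj {A : Mat n} {V : ℝ → Mat n}
    (h : ∀ t, HasDerivAt V ((1 / 2 : ℝ) • (V t * A + Aᵀ * V t)) t) (t : ℝ) :
    V t = (aiProp A t)ᵀ * V 0 * aiProp A t := by
  have hc : ∀ t, HasDerivAt (fun s => (aiProp (-A) s)ᵀ * V s * aiProp (-A) s) 0 t := fun t => by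
    have h2 := hasDerivAt_aiProp (-A) t
    refine (((hasDerivAt_transpose h2).mul (h t)).mul h2).congr_deriv ?_
    have hcomm := aiProp_comm (-A) t
    rw [Matrix.mul_smul, hcomm]
    simp only [Matrix.transpose_smul, Matrix.transpose_mul]
    have hcommT : Aᵀ * (aiProp (-A) t)ᵀ = (aiProp (-A) t)ᵀ * Aᵀ := by
      rw [← Matrix.transpose_mul, ← Matrix.transpose_mul]
      exact congrArg Matrix.transpose (by simpa using hcomm)
    simp only [Matrix.transpose_neg, Matrix.mul_smul, Matrix.smul_mul, Matrix.neg_mul,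
      Matrix.mul_neg, Matrix.mul_add, Matrix.add_mul, smul_add, Matrix.mul_assoc, smul_neg]
    simp only [← Matrix.mul_assoc, ← hcommT, Pi.mul_apply]
    abel
  have h0 := eq_of_hasDerivAt_zero hc t
  simp only [aiProp_zero, Matrix.transpose_one, one_mul, mul_one] at h0
  have hi := aiProp_neg_mul A t
  have hiT : (aiProp A t)ᵀ * (aiProp (-A) t)ᵀ = 1 := by
    rw [← Matrix.transpose_mul, hi, Matrix.transpose_one]
  rw [← h0]
  calc V t = ((aiProp A t)ᵀ * (aiProp (-A) t)ᵀ) * V t * (aiProp (-A) t * aiProp A t) := by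
        rw [hi, hiT, one_mul, mul_one]
    _ = _ := by simp only [Matrix.mul_assoc]

/-- The affine-invariant geodesic with initial point `P` and initial velocity `W`. -/
noncomputable def aiCurve (P W : Mat n) (t : ℝ) : Mat n :=
  (aiProp (P⁻¹ * W) t)ᵀ * P * aiProp (P⁻¹ * W) t

theorem aiCurve_zero (P W : Mat n) : aiCurve P W 0 = P := by simp [aiCurve, aiProp_zero]

theorem posDef_aiCurve {P : Mat n} (hP : P.PosDef) (W : Mat n) (t : ℝ) :
    (aiCurve P W t).PosDef :=
  posDef_transpose_mul_mul hP (isUnit_exp _)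

theorem mul_inv_mul_cancel {P : Mat n} (hP : P.PosDef) (W : Mat n) : P * (P⁻¹ * W) = W :=
  Matrix.mul_nonsing_inv_cancel_left _ _ (isUnit_det_of_posDef hP)

/-- `A = P⁻¹ W` commutes with its propagator and can be moved next to `P`, where `P A = W`. With the
transposed identity below, this yields `γ' = γ A = Aᵀ γ`. -/
theorem aiCurve_mul {P : Mat n} (hP : P.PosDef) (W : Mat n) (t : ℝ) :
    aiCurve P W t * (P⁻¹ * W) = (aiProp (P⁻¹ * W) t)ᵀ * W * aiProp (P⁻¹ * W) t := by
  rw [aiCurve, Matrix.mul_assoc, aiProp_comm]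
  rw [← Matrix.mul_assoc, Matrix.mul_assoc _ P, mul_inv_mul_cancel hP]

theorem transpose_mul_aiCurve {P W : Mat n} (hP : P.PosDef) (hW : W.IsSymm) (t : ℝ) :
    (P⁻¹ * W)ᵀ * aiCurve P W t = (aiProp (P⁻¹ * W) t)ᵀ * W * aiProp (P⁻¹ * W) t := by
  have h := congrArg Matrix.transpose (aiCurve_mul hP W t)
  rw [Matrix.transpose_mul, (isSymm_of_posDef (posDef_aiCurve hP W t)).eq] at h
  rw [h]
  simp only [Matrix.transpose_mul, Matrix.transpose_transpose, hW.eq, Matrix.mul_assoc]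

theorem hasDerivAt_aiCurve {P W : Mat n} (hP : P.PosDef) (hW : W.IsSymm) (t : ℝ) :
    HasDerivAt (aiCurve P W) ((aiProp (P⁻¹ * W) t)ᵀ * W * aiProp (P⁻¹ * W) t) t := by
  refine (hasDerivAt_aiProp_conj (P⁻¹ * W) P t).congr_deriv ?_
  have h1 := aiCurve_mul hP W t
  have h2 := transpose_mul_aiCurve hP hW t
  rw [aiCurve] at h1 h2
  rw [h1, h2, ← two_smul ℝ, smul_smul]
  norm_num

theorem isParallelAlong_aiCurve {β : ℝ} (hβ : -1 / (n : ℝ) < β) {P W U : Mat n}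
    (hP : P.PosDef) (hW : W.IsSymm) (hU : U.IsSymm) :
    IsParallelAlong (aiMetric β) (aiCurve P W)
      (fun t => (aiProp (P⁻¹ * W) t)ᵀ * U * aiProp (P⁻¹ * W) t) := by
  rw [isParallelAlong_aiMetric_iff hβ (posDef_aiCurve hP W)
    fun t => (hasDerivAt_aiCurve hP hW t).differentiableAt]
  refine ⟨fun t => ?_, fun t => (hasDerivAt_aiProp_conj _ _ _).congr_deriv ?_⟩
  · simp only [Matrix.IsSymm, Matrix.transpose_mul, Matrix.transpose_transpose, hU.eq,
      Matrix.mul_assoc]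
  · have hu := isUnit_det_of_posDef (posDef_aiCurve hP W t)
    rw [(hasDerivAt_aiCurve hP hW t).deriv]
    -- Substituting `γ' = γ A` on one side and `γ' = Aᵀ γ` on the other cancels both factors `γ⁻¹`.
    conv_rhs =>
      rw [Matrix.mul_assoc _ (aiCurve P W t)⁻¹, ← aiCurve_mul hP,
        Matrix.nonsing_inv_mul_cancel_left _ _ hu, aiCurve_mul hP,
        ← transpose_mul_aiCurve hP hW, Matrix.mul_nonsing_inv_cancel_right _ _ hu]

theorem isGeodesic_aiCurve {β : ℝ} (hβ : -1 / (n : ℝ) < β) {P W : Mat n}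
    (hP : P.PosDef) (hW : W.IsSymm) : IsGeodesic (aiMetric β) (aiCurve P W) := by
  refine ⟨posDef_aiCurve hP W, fun t => (hasDerivAt_aiCurve hP hW t).differentiableAt, ?_⟩
  have : deriv (aiCurve P W) = fun t => (aiProp (P⁻¹ * W) t)ᵀ * W * aiProp (P⁻¹ * W) t :=
    funext fun t => (hasDerivAt_aiCurve hP hW t).deriv
  rw [this]
  exact isParallelAlong_aiCurve hβ hP hW hW

theorem parallel_aiCurve_unique {β : ℝ} (hβ : -1 / (n : ℝ) < β) {P W : Mat n} {V : ℝ → Mat n}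
    (hP : P.PosDef) (hW : W.IsSymm) (hV : IsParallelAlong (aiMetric β) (aiCurve P W) V) (t : ℝ) :
    V t = (aiProp (P⁻¹ * W) t)ᵀ * V 0 * aiProp (P⁻¹ * W) t := by
  rw [isParallelAlong_aiMetric_iff hβ (posDef_aiCurve hP W)
    fun t => (hasDerivAt_aiCurve hP hW t).differentiableAt] at hV
  refine eq_aiProp_conj (fun t => (hV.2 t).congr_deriv ?_) t
  have hu := isUnit_det_of_posDef (posDef_aiCurve hP W t)
  rw [(hasDerivAt_aiCurve hP hW t).deriv]
  conv_lhs =>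
    rw [Matrix.mul_assoc _ (aiCurve P W t)⁻¹, ← aiCurve_mul hP,
      Matrix.nonsing_inv_mul_cancel_left _ _ hu, aiCurve_mul hP,
      ← transpose_mul_aiCurve hP hW, Matrix.mul_nonsing_inv_cancel_right _ _ hu]

/-- The geodesic equation reads `γ'' = γ' γ⁻¹ γ'`, so `γ⁻¹ γ'` has zero derivative. With its
constant value `A`, the curve satisfies the linear equation solved by `eq_aiProp_conj`. -/
theorem geodesic_aiMetric_unique {β : ℝ} (hβ : -1 / (n : ℝ) < β) {γ : ℝ → Mat n}
    (hγ : IsGeodesic (aiMetric β) γ) : γ = aiCurve (γ 0) (deriv γ 0) := by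
  obtain ⟨hpos, hd, hpar⟩ := hγ
  rw [isParallelAlong_aiMetric_iff hβ hpos hd] at hpar
  have hγs : ∀ t, (γ t).IsSymm := fun t => isSymm_of_posDef (hpos t)
  set A := (γ 0)⁻¹ * deriv γ 0
  have hA : ∀ t, (γ t)⁻¹ * deriv γ t = A := by
    refine fun t => eq_of_hasDerivAt_zero (f := fun t => (γ t)⁻¹ * deriv γ t) (fun t => ?_) t
    refine ((hasDerivAt_inv (hd t).hasDerivAt (hpos t).isUnit).mul (hpar.2 t)).congr_deriv ?_
    rw [← two_smul ℝ (deriv γ t * _ * _), smul_smul]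
    norm_num [Matrix.mul_assoc]
  have hA1 : ∀ t, deriv γ t = γ t * A := fun t => by
    rw [← hA t, Matrix.mul_nonsing_inv_cancel_left _ _ (isUnit_det_of_posDef (hpos t))]
  have hA2 : ∀ t, deriv γ t = Aᵀ * γ t := fun t => by
    have := congrArg Matrix.transpose (hA1 t)
    rwa [(hpar.1 t).eq, Matrix.transpose_mul, (hγs t).eq] at this
  ext1 t
  refine eq_aiProp_conj (fun t => (hd t).hasDerivAt.congr_deriv ?_) t
  rw [← hA1, ← hA2, ← two_smul ℝ, smul_smul]
  norm_num

/-- `P⁻¹ W` is similar, through `R`, to `R⁻¹ W R⁻¹`, and the exponential respects similarity. -/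
theorem aiProp_eq_of_sqrt {P R : Mat n} (hRu : IsUnit R) (hR : R * R = P) (W : Mat n) :
    aiProp (P⁻¹ * W) 1 = R⁻¹ * exp ((1 / 2 : ℝ) • (R⁻¹ * W * R⁻¹)) * R := by
  rw [← Matrix.exp_conj' R _ hRu, aiProp, one_smul, ← hR, Matrix.mul_inv_rev]
  congr 1
  have hdet := (Matrix.isUnit_iff_isUnit_det R).1 hRu
  simp only [Matrix.mul_smul, Matrix.smul_mul, Matrix.mul_assoc, Matrix.nonsing_inv_mul R hdet,
    Matrix.mul_one]

theorem aiCurve_one_of_sqrt {P R W : Mat n} (hRs : R.IsSymm) (hRu : IsUnit R) (hR : R * R = P)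
    (hW : W.IsSymm) : aiCurve P W 1 = R * exp (R⁻¹ * W * R⁻¹) * R := by
  have hdet := (Matrix.isUnit_iff_isUnit_det R).1 hRu
  have hRi : (R⁻¹)ᵀ = R⁻¹ := by rw [Matrix.transpose_nonsing_inv, hRs.eq]
  have hS : (R⁻¹ * W * R⁻¹).IsSymm := by
    simp only [Matrix.IsSymm, Matrix.transpose_mul, hRi, hW.eq, Matrix.mul_assoc]
  rw [aiCurve, aiProp_eq_of_sqrt hRu hR]
  generalize R⁻¹ * W * R⁻¹ = S at hS ⊢
  rw [← exp_half_mul_self S]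
  simp only [Matrix.transpose_mul, (isSymm_exp_half hS).eq, hRs.eq, hRi, Matrix.mul_assoc,
    ← hR, Matrix.mul_nonsing_inv_cancel_left _ _ hdet, Matrix.nonsing_inv_mul_cancel_left _ _ hdet]

/-! ### Closed forms of the affine-invariant exponential, logarithm and transport. -/

theorem expMap_aiMetric {β : ℝ} (hβ : -1 / (n : ℝ) < β) {P R W : Mat n} (hP : P.PosDef)
    (hRs : R.IsSymm) (hRu : IsUnit R) (hR : R * R = P) (hW : W.IsSymm) :
    expMap (aiMetric β) P W = R * exp (R⁻¹ * W * R⁻¹) * R := by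
  rw [← aiCurve_one_of_sqrt hRs hRu hR hW]
  refine epsilon_eq_of_unique ⟨aiCurve P W, isGeodesic_aiCurve hβ hP hW, aiCurve_zero P W, ?_, rfl⟩
    ?_
  · rw [(hasDerivAt_aiCurve hP hW 0).deriv]
    simp [aiProp_zero]
  · rintro Q ⟨γ, hγ, h0, h0', h1⟩
    rw [← h1, geodesic_aiMetric_unique hβ hγ, h0, h0']

theorem eq_of_mul_exp_mul_eq {R W Q : Mat n} (hRs : R.IsSymm) (hRu : IsUnit R) (hW : W.IsSymm)
    (h : R * exp (R⁻¹ * W * R⁻¹) * R = Q) : W = R * matLog (R⁻¹ * Q * R⁻¹) * R := by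
  have hdet := (Matrix.isUnit_iff_isUnit_det R).1 hRu
  have hRi : (R⁻¹)ᵀ = R⁻¹ := by rw [Matrix.transpose_nonsing_inv, hRs.eq]
  have hS : (R⁻¹ * W * R⁻¹).IsSymm := by
    simp only [Matrix.IsSymm, Matrix.transpose_mul, hRi, hW.eq, Matrix.mul_assoc]
  have : R⁻¹ * Q * R⁻¹ = exp (R⁻¹ * W * R⁻¹) := by
    rw [← h, Matrix.mul_assoc, Matrix.mul_nonsing_inv_cancel_right _ _ hdet,
      Matrix.nonsing_inv_mul_cancel_left _ _ hdet]
  rw [this, matLog_exp hS, Matrix.mul_assoc R, Matrix.nonsing_inv_mul_cancel_right _ _ hdet,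
    Matrix.mul_nonsing_inv_cancel_left _ _ hdet]

theorem posDef_sqrt_conj {R Q : Mat n} (hRs : R.IsSymm) (hRu : IsUnit R) (hQ : Q.PosDef) :
    (R⁻¹ * Q * R⁻¹).PosDef := by
  have h := posDef_transpose_mul_mul hQ (Matrix.isUnit_nonsing_inv_iff.2 hRu)
  rwa [Matrix.transpose_nonsing_inv, hRs.eq] at h

theorem mul_exp_conj_matLog {R Q : Mat n} (hRs : R.IsSymm) (hRu : IsUnit R) (hQ : Q.PosDef) :
    R * exp (R⁻¹ * (R * matLog (R⁻¹ * Q * R⁻¹) * R) * R⁻¹) * R = Q := by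
  have hdet := (Matrix.isUnit_iff_isUnit_det R).1 hRu
  rw [Matrix.mul_assoc R (matLog _), Matrix.nonsing_inv_mul_cancel_left _ _ hdet,
    Matrix.mul_nonsing_inv_cancel_right _ _ hdet, exp_matLog (posDef_sqrt_conj hRs hRu hQ),
    Matrix.mul_assoc, Matrix.nonsing_inv_mul_cancel_right _ _ hdet,
    Matrix.mul_nonsing_inv_cancel_left _ _ hdet]

theorem isSymm_conj {R S : Mat n} (hRs : R.IsSymm) (hS : S.IsSymm) : (R * S * R).IsSymm := by
  simp only [Matrix.IsSymm, Matrix.transpose_mul, hRs.eq, hS.eq, Matrix.mul_assoc]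

theorem logMap_aiMetric {β : ℝ} (hβ : -1 / (n : ℝ) < β) {P R Q : Mat n} (hP : P.PosDef)
    (hRs : R.IsSymm) (hRu : IsUnit R) (hR : R * R = P) (hQ : Q.PosDef) :
    logMap (aiMetric β) P Q = R * matLog (R⁻¹ * Q * R⁻¹) * R := by
  have hs : (R * matLog (R⁻¹ * Q * R⁻¹) * R).IsSymm := isSymm_conj hRs (isSymm_matLog _)
  refine epsilon_eq_of_unique ⟨hs, ?_⟩ ?_
  · rw [expMap_aiMetric hβ hP hRs hRu hR hs, mul_exp_conj_matLog hRs hRu hQ]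
  · rintro W ⟨hW, h⟩
    rw [expMap_aiMetric hβ hP hRs hRu hR hW] at h
    exact eq_of_mul_exp_mul_eq hRs hRu hW h

theorem transport_aiMetric_one {β : ℝ} (hβ : -1 / (n : ℝ) < β) {P W : Mat n} (hP : P.PosDef)
    (hW : W.IsSymm) : transport (aiMetric β) P 1 W =
      exp ((1 / 2 : ℝ) • -matLog P) * W * exp ((1 / 2 : ℝ) • -matLog P) := by
  have hL := isSymm_matLog P
  set R := exp ((1 / 2 : ℝ) • matLog P) with hRdef
  have hRs : R.IsSymm := isSymm_exp_half hL
  have hRu : IsUnit R := isUnit_exp _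
  have hR : R * R = P := by rw [hRdef, exp_half_mul_self, exp_matLog hP]
  have hRinv : exp ((1 / 2 : ℝ) • -matLog P) = R⁻¹ := by rw [smul_neg, Matrix.exp_neg]
  have hdet := (Matrix.isUnit_iff_isUnit_det R).1 hRu
  -- `Y` is `Log_P 1`, the initial velocity of the geodesic from `P` to `1`.
  set Y := R * matLog (R⁻¹ * 1 * R⁻¹) * R with hY
  have hYs : Y.IsSymm := isSymm_conj hRs (isSymm_matLog _)
  -- Here `R⁻¹ Y R⁻¹ = -log P`, so the propagator at time `1` is `R⁻¹ R⁻¹ R = R⁻¹`.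
  have hprop : aiProp (P⁻¹ * Y) 1 = R⁻¹ := by
    rw [aiProp_eq_of_sqrt hRu hR, hY, Matrix.mul_assoc R (matLog _),
      Matrix.nonsing_inv_mul_cancel_left _ _ hdet, Matrix.mul_nonsing_inv_cancel_right _ _ hdet,
      mul_one, ← Matrix.mul_inv_rev, hR, matLog_inv hP, hRinv,
      Matrix.nonsing_inv_mul_cancel_right _ _ hdet]
  have hRi : (R⁻¹)ᵀ = R⁻¹ := by rw [Matrix.transpose_nonsing_inv, hRs.eq]
  rw [hRinv]
  refine epsilon_eq_of_unique ⟨aiCurve P Y, _, isGeodesic_aiCurve hβ hP hYs, aiCurve_zero P Y, ?_,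
    isParallelAlong_aiCurve hβ hP hYs hW, ?_, ?_⟩ ?_
  · rw [aiCurve_one_of_sqrt hRs hRu hR hYs, mul_exp_conj_matLog hRs hRu Matrix.PosDef.one]
  · simp [aiProp_zero]
  · simp only [hprop, hRi]
  -- Reaching `1` at time `1` forces the initial velocity to be `Y`, so every admissible geodesic is
  -- `aiCurve P Y`.
  · rintro X ⟨γ, V, hγ, h0, h1, hV, hV0, rfl⟩
    have hW' : (deriv γ 0).IsSymm := hγ.parallel.isSymm 0
    have hc := geodesic_aiMetric_unique hβ hγ
    rw [h0] at hc
    rw [hc, aiCurve_one_of_sqrt hRs hRu hR hW'] at h1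
    have hYeq := eq_of_mul_exp_mul_eq hRs hRu hW' h1
    rw [hYeq] at hc
    rw [hc] at hV
    rw [parallel_aiCurve_unique hβ hP hYs hV, hV0, hprop, hRi]

/-- Congruence by `R` is an isometry from the tangent space at `1` to that at `P`. This carries the
pairing at `P` to the identity. -/
theorem aiMetric_sqrt_conj (β : ℝ) {P R : Mat n} (hRu : IsUnit R) (hR : R * R = P)
    (X W : Mat n) : aiMetric β P (R * X * R) W = aiMetric β 1 X (R⁻¹ * W * R⁻¹) := by
  have hdet := (Matrix.isUnit_iff_isUnit_det R).1 hRu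
  have hPi : P⁻¹ = R⁻¹ * R⁻¹ := by rw [← hR, Matrix.mul_inv_rev]
  simp only [aiMetric, inv_one, Matrix.mul_one, hPi]
  have h1 : (R * X * R * (R⁻¹ * R⁻¹)).trace = X.trace := by
    rw [← Matrix.mul_assoc, Matrix.mul_nonsing_inv_cancel_right _ _ hdet, Matrix.trace_mul_comm,
      Matrix.nonsing_inv_mul_cancel_left _ _ hdet]
  have h2 : (W * (R⁻¹ * R⁻¹)).trace = (R⁻¹ * W * R⁻¹).trace := by
    rw [Matrix.trace_mul_comm (R⁻¹ * W), ← Matrix.mul_assoc R⁻¹, Matrix.trace_mul_comm W]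
  have h3 : (R * X * R * (R⁻¹ * R⁻¹) * W * (R⁻¹ * R⁻¹)).trace =
      (X * (R⁻¹ * W * R⁻¹)).trace := by
    simp only [Matrix.mul_assoc, Matrix.mul_nonsing_inv_cancel_left _ _ hdet]
    rw [Matrix.trace_mul_comm R]
    simp only [Matrix.mul_assoc, Matrix.nonsing_inv_mul _ hdet, Matrix.mul_one]
  rw [h1, h2, h3]

theorem hypergyroplane_ai {β : ℝ} (hβ : -1 / (n : ℝ) < β) {P W Q : Mat n} (hP : P.PosDef)
    (hW : W.IsSymm) (hQ : Q.PosDef) :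
    aiMetric β P (logMap (aiMetric β) P Q) W = (Geometry.ai β hβ).spdInner
      ((Geometry.ai β hβ).add ((Geometry.ai β hβ).neg P) Q)
      (expMap (aiMetric β) 1 (transport (aiMetric β) P 1 W)) := by
  have hL := isSymm_matLog P
  set R := exp ((1 / 2 : ℝ) • matLog P) with hRdef
  have hRs : R.IsSymm := isSymm_exp_half hL
  have hRu : IsUnit R := isUnit_exp _
  have hR : R * R = P := by rw [hRdef, exp_half_mul_self, exp_matLog hP]
  have hRinv : exp ((1 / 2 : ℝ) • -matLog P) = R⁻¹ := by rw [smul_neg, Matrix.exp_neg]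
  have hRi : (R⁻¹).IsSymm := by rw [Matrix.IsSymm, Matrix.transpose_nonsing_inv, hRs.eq]
  have hWs : (R⁻¹ * W * R⁻¹).IsSymm := isSymm_conj hRi hW
  have hlog : ∀ {S : Mat n}, S.PosDef → logMap (aiMetric β) 1 S = matLog S := fun hS => by
    rw [logMap_aiMetric hβ Matrix.PosDef.one Matrix.isSymm_one isUnit_one (one_mul 1) hS]
    simp
  have hexp : expMap (aiMetric β) 1 (R⁻¹ * W * R⁻¹) = exp (R⁻¹ * W * R⁻¹) := by
    rw [expMap_aiMetric hβ Matrix.PosDef.one Matrix.isSymm_one isUnit_one (one_mul 1) hWs]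
    simp
  simp only [Geometry.spdInner, Geometry.add, Geometry.neg, Geometry.metric]
  rw [matSqrt_inv hP, transport_aiMetric_one hβ hP hW, hRinv, hexp, hlog (posDef_exp hWs),
    hlog (posDef_sqrt_conj hRs hRu hQ), matLog_exp hWs,
    logMap_aiMetric hβ hP hRs hRu hR hQ, aiMetric_sqrt_conj β hRu hR]

/-! ### Flat metrics in a global chart -/

/-- The space of symmetric matrices. -/
def symSubmodule (n : ℕ) : Submodule ℝ (Mat n) where
  carrier := {S | S.IsSymm}
  add_mem' := fun ha hb => ha.add hb
  zero_mem' := Matrix.isSymm_zero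
  smul_mem' := fun c _ h => h.smul c

/-- The symmetric part of a matrix. -/
noncomputable def symPart (n : ℕ) : Mat n →L[ℝ] symSubmodule n :=
  LinearMap.toContinuousLinearMap
    { toFun := fun M => ⟨(1 / 2 : ℝ) • (M + Mᵀ), (Matrix.isSymm_add_transpose_self M).smul _⟩
      map_add' := fun M N => Subtype.ext <| by
        simp only [Matrix.transpose_add, Submodule.coe_add, ← smul_add]
        congr 1
        abel
      map_smul' := fun c M => Subtype.ext <| by
        simp only [Matrix.transpose_smul, ← smul_add, Submodule.coe_smul, RingHom.id_apply]
        rw [smul_comm] }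

theorem coe_symPart {S : Mat n} (hS : S.IsSymm) : (symPart n S : Mat n) = S := by
  change (1 / 2 : ℝ) • (S + Sᵀ) = S
  rw [hS.eq, ← two_smul ℝ, smul_smul]
  norm_num

theorem symPart_coe (S : symSubmodule n) : symPart n (S : Mat n) = S :=
  Subtype.ext (coe_symPart S.2)

/-- The inverse function theorem for a map with a global left inverse. -/
theorem exists_equiv_inverse {E : Type*} [NormedAddCommGroup E] [NormedSpace ℝ E]
    [FiniteDimensional ℝ E] {f g : E → E} {a : E} (hf : ContDiffAt ℝ 2 f a)
    (hinj : Function.Injective (fderiv ℝ f a)) (hg : ∀ x, g (f x) = x) :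
    ∃ e : E ≃L[ℝ] E, (∀ x, e x = fderiv ℝ f a x) ∧
      HasFDerivAt g (e.symm : E →L[ℝ] E) (f a) ∧ ContDiffAt ℝ 2 g (f a) ∧
      Filter.map f (𝓝 a) = 𝓝 (f a) := by
  have : CompleteSpace E := FiniteDimensional.complete ℝ E
  let e : E ≃L[ℝ] E :=
    (LinearEquiv.ofInjectiveEndo (fderiv ℝ f a).toLinearMap hinj).toContinuousLinearEquiv
  have he : (e : E →L[ℝ] E) = fderiv ℝ f a := by ext x; rfl
  have hs : HasStrictFDerivAt f (e : E →L[ℝ] E) a := by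
    rw [he]; exact hf.hasStrictFDerivAt two_ne_zero
  -- Near `f a` each `y` is `f` of its local inverse, so applying `g` shows that `g` is the local
  -- inverse there.
  have hgl : g =ᶠ[𝓝 (f a)] hs.localInverse f e a := by
    filter_upwards [hs.eventually_right_inverse] with y hy
    rw [← hg (hs.localInverse f e a y), hy]
  refine ⟨e, fun x => rfl, ?_, ?_, hs.map_nhds_eq_of_equiv⟩
  · exact hs.to_localInverse.hasFDerivAt.congr_of_eventuallyEq hgl
  · exact (hf.to_localInverse (f' := e) hs.hasFDerivAt two_ne_zero).congr_of_eventuallyEq hgl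

/-- The base point `p` is kept apart from `γ t` so that `P + 0 • Z` can be replaced by `P` without
rewriting inside the derivative. -/
theorem hasDerivAt_family_apply {E F : Type*} [NormedAddCommGroup E] [NormedSpace ℝ E]
    [NormedAddCommGroup F] [NormedSpace ℝ F] {D : E → E →L[ℝ] F} {D' : E →L[ℝ] E →L[ℝ] F}
    {γ V : ℝ → E} {p γ' V' : E} {t : ℝ} (hD : HasFDerivAt D D' p) (hp : γ t = p)
    (hγ : HasDerivAt γ γ' t) (hV : HasDerivAt V V' t) :
    HasDerivAt (fun s => D (γ s) (V s)) (D' γ' (V t) + D p V') t := by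
  subst hp
  exact (hD.comp_hasDerivAt t hγ).clm_apply hV

theorem hasDerivAt_bilinear {F : Type*} [NormedAddCommGroup F] [NormedSpace ℝ F]
    (B : F →L[ℝ] F →L[ℝ] ℝ) {x y : ℝ → F} {x' y' : F} {t : ℝ} (hx : HasDerivAt x x' t)
    (hy : HasDerivAt y y' t) :
    HasDerivAt (fun s => B (x s) (y s)) (B x' (y t) + B (x t) y') t :=
  (B.hasFDerivAt.comp_hasDerivAt t hx).clm_apply hy

/-- A global parametrization `param` of the positive definite matrices, with inverse `coord`, in
which the metric `G` has constant coefficients. -/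
structure FlatChart (G : Mat n → Mat n → Mat n → ℝ) where
  param : symSubmodule n → symSubmodule n
  coord : symSubmodule n → symSubmodule n
  form : symSubmodule n →L[ℝ] symSubmodule n →L[ℝ] ℝ
  contDiff_param : ContDiff ℝ 2 param
  injective_fderiv : ∀ f, Function.Injective (fderiv ℝ param f)
  posDef_param : ∀ f, (param f : Mat n).PosDef
  coord_param : ∀ f, coord (param f) = f
  param_coord : ∀ p : symSubmodule n, (p : Mat n).PosDef → param (coord p) = p
  form_symm : ∀ x y, form x y = form y x
  form_definite : ∀ x, form x x = 0 → x = 0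
  metric_eq : ∀ f x y, G (param f) (fderiv ℝ param f x) (fderiv ℝ param f y) = form x y

/-! ### Levi-Civita calculus in a flat chart. -/

namespace FlatChart

variable {G : Mat n → Mat n → Mat n → ℝ} (c : FlatChart G)

/-- The derivative of the parametrization as a linear equivalence. -/
noncomputable def equiv (f : symSubmodule n) : symSubmodule n ≃L[ℝ] symSubmodule n :=
  (exists_equiv_inverse c.contDiff_param.contDiffAt (c.injective_fderiv f) c.coord_param).choose

theorem equiv_apply (f x : symSubmodule n) : c.equiv f x = fderiv ℝ c.param f x :=
  (exists_equiv_inverse c.contDiff_param.contDiffAt (c.injective_fderiv f)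
    c.coord_param).choose_spec.1 x

theorem hasFDerivAt_coord (f : symSubmodule n) :
    HasFDerivAt c.coord ((c.equiv f).symm : symSubmodule n →L[ℝ] symSubmodule n) (c.param f) :=
  (exists_equiv_inverse c.contDiff_param.contDiffAt (c.injective_fderiv f)
    c.coord_param).choose_spec.2.1

theorem contDiffAt_coord (f : symSubmodule n) : ContDiffAt ℝ 2 c.coord (c.param f) :=
  (exists_equiv_inverse c.contDiff_param.contDiffAt (c.injective_fderiv f)
    c.coord_param).choose_spec.2.2.1

theorem map_nhds_param (f : symSubmodule n) : Filter.map c.param (𝓝 f) = 𝓝 (c.param f) :=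
  (exists_equiv_inverse c.contDiff_param.contDiffAt (c.injective_fderiv f)
    c.coord_param).choose_spec.2.2.2

/-- The chart on all matrices, through the symmetric part. -/
noncomputable def chart (M : Mat n) : symSubmodule n := c.coord (symPart n M)

theorem param_chart {P : Mat n} (hP : P.PosDef) : (c.param (c.chart P) : Mat n) = P := by
  have h := coe_symPart (isSymm_of_posDef hP)
  rw [chart, c.param_coord _ (by rwa [h]), h]

theorem param_chart_eq {P : Mat n} (hP : P.PosDef) : c.param (c.chart P) = symPart n P := by
  rw [← symPart_coe (c.param (c.chart P)), c.param_chart hP]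

theorem chart_param (f : symSubmodule n) : c.chart (c.param f) = f := by
  rw [chart, symPart_coe, c.coord_param]

theorem contDiffAt_chart {P : Mat n} (hP : P.PosDef) : ContDiffAt ℝ 2 c.chart P := by
  have h := c.contDiffAt_coord (c.chart P)
  rw [c.param_chart_eq hP] at h
  exact h.comp P (symPart n).contDiff.contDiffAt

theorem hasFDerivAt_chart {P : Mat n} (hP : P.PosDef) : HasFDerivAt c.chart
    (((c.equiv (c.chart P)).symm : symSubmodule n →L[ℝ] symSubmodule n).comp (symPart n)) P := by
  have h := c.hasFDerivAt_coord (c.chart P)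
  rw [c.param_chart_eq hP] at h
  exact h.comp P (symPart n).hasFDerivAt

/-- The derivative of the chart. -/
noncomputable def dChart (P : Mat n) : Mat n →L[ℝ] symSubmodule n := fderiv ℝ c.chart P

theorem dChart_apply {P : Mat n} (hP : P.PosDef) (V : Mat n) :
    c.dChart P V = (c.equiv (c.chart P)).symm (symPart n V) := by
  rw [dChart, (c.hasFDerivAt_chart hP).fderiv]
  rfl

theorem equiv_dChart {P V : Mat n} (hP : P.PosDef) (hV : V.IsSymm) :
    (c.equiv (c.chart P) (c.dChart P V) : Mat n) = V := by
  rw [c.dChart_apply hP, ContinuousLinearEquiv.apply_symm_apply, coe_symPart hV]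

theorem dChart_equiv {P : Mat n} (hP : P.PosDef) (x : symSubmodule n) :
    c.dChart P (c.equiv (c.chart P) x) = x := by
  rw [c.dChart_apply hP, symPart_coe, ContinuousLinearEquiv.symm_apply_apply]

theorem metric_eq_form {P V W : Mat n} (hP : P.PosDef) (hV : V.IsSymm) (hW : W.IsSymm) :
    G P V W = c.form (c.dChart P V) (c.dChart P W) := by
  rw [← c.metric_eq (c.chart P), ← c.equiv_apply, ← c.equiv_apply, c.equiv_dChart hP hV,
    c.equiv_dChart hP hW, c.param_chart hP]

/-- Openness comes from the chart: `param` maps neighbourhoods onto neighbourhoods and takes only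
positive definite values. -/
theorem eventually_posDef (c : FlatChart G) {P Z : Mat n} (hP : P.PosDef) (hZ : Z.IsSymm) :
    ∀ᶠ s : ℝ in 𝓝 0, (P + s • Z).PosDef := by
  have h1 : ∀ᶠ p : symSubmodule n in 𝓝 (c.param (c.chart P)), (p : Mat n).PosDef := by
    rw [← c.map_nhds_param]
    exact Filter.eventually_map.2 (Filter.Eventually.of_forall c.posDef_param)
  rw [c.param_chart_eq hP] at h1
  have hc : Filter.Tendsto (fun s : ℝ => symPart n (P + s • Z)) (𝓝 0) (𝓝 (symPart n P)) := by
    have := (symPart n).continuous.continuousAt.comp (hasDerivAt_line P Z).continuousAt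
    simpa only [ContinuousAt, Function.comp_def, zero_smul, add_zero] using this
  filter_upwards [hc.eventually h1] with s hs
  rwa [coe_symPart ((isSymm_of_posDef hP).add (hZ.smul s))] at hs

/-- The second derivative of the chart. -/
noncomputable def ddChart (P : Mat n) : Mat n →L[ℝ] Mat n →L[ℝ] symSubmodule n :=
  fderiv ℝ c.dChart P

theorem hasFDerivAt_dChart {P : Mat n} (hP : P.PosDef) :
    HasFDerivAt c.dChart (c.ddChart P) P :=
  (((c.contDiffAt_chart hP).fderiv_right (m := 1) (by norm_num)).differentiableAt
    one_ne_zero).hasFDerivAt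

/-- Schwarz's theorem, for which the chart is required to be `C²`. -/
theorem ddChart_symm {P : Mat n} (hP : P.PosDef) (Z V : Mat n) :
    c.ddChart P Z V = c.ddChart P V Z :=
  ((c.contDiffAt_chart hP).isSymmSndFDerivAt (by simp)).eq Z V

theorem metricDeriv_eq {P Z V W : Mat n} (hP : P.PosDef) (hZ : Z.IsSymm) (hV : V.IsSymm)
    (hW : W.IsSymm) : metricDeriv G P Z V W =
      c.form (c.ddChart P Z V) (c.dChart P W) + c.form (c.dChart P V) (c.ddChart P Z W) := by
  have h0 : P + (0 : ℝ) • Z = P := by rw [zero_smul, add_zero]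
  have hX : ∀ X : Mat n, HasDerivAt (fun s : ℝ => c.dChart (P + s • Z) X) (c.ddChart P Z X) 0 :=
    fun X => (hasDerivAt_family_apply (c.hasFDerivAt_dChart hP) h0 (hasDerivAt_line P Z)
      (hasDerivAt_const (0 : ℝ) X)).congr_deriv (by rw [map_zero, add_zero])
  have hB := hasDerivAt_bilinear c.form (hX V) (hX W)
  simp only [h0] at hB
  -- `G` is known to be the pulled-back form only at positive definite points, so the two functions
  -- of `s` agree only near `0`.
  refine HasDerivAt.deriv (hB.congr_of_eventuallyEq ?_)
  filter_upwards [c.eventually_posDef hP hZ] with s hs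
  exact c.metric_eq_form hs hV hW

/-- In a flat chart the covariant derivative is the derivative of the coordinates. -/
theorem covariant_eq {P Z V X W : Mat n} (hP : P.PosDef) (hZ : Z.IsSymm) (hV : V.IsSymm)
    (hX : X.IsSymm) (hW : W.IsSymm) :
    G P X W + 1 / 2 * (metricDeriv G P Z V W + metricDeriv G P V Z W - metricDeriv G P W Z V) =
      c.form (c.ddChart P Z V + c.dChart P X) (c.dChart P W) := by
  -- Of the six second-derivative terms, symmetry makes two equal to `form (ddChart P Z V) (dChart P
  -- W)` and cancels the other four in pairs.
  rw [c.metric_eq_form hP hX hW, c.metricDeriv_eq hP hZ hV hW, c.metricDeriv_eq hP hV hZ hW,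
    c.metricDeriv_eq hP hW hZ hV, map_add, add_apply, c.ddChart_symm hP V Z,
    c.ddChart_symm hP W Z, c.ddChart_symm hP W V, c.form_symm (c.ddChart P Z W)]
  ring

theorem isParallelAlong_iff {γ V : ℝ → Mat n} (hγ : ∀ t, (γ t).PosDef)
    (hd : ∀ t, DifferentiableAt ℝ γ t) :
    IsParallelAlong G γ V ↔ (∀ t, (V t).IsSymm) ∧ (∀ t, DifferentiableAt ℝ V t) ∧
      ∀ t, HasDerivAt (fun s => c.dChart (γ s) (V s)) 0 t := by
  have hγs : ∀ t, (deriv γ t).IsSymm := fun t =>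
    isSymm_deriv (fun t => isSymm_of_posDef (hγ t)) (hd t)
  have hder : ∀ t, DifferentiableAt ℝ V t → HasDerivAt (fun s => c.dChart (γ s) (V s))
      (c.ddChart (γ t) (deriv γ t) (V t) + c.dChart (γ t) (deriv V t)) t := fun t hV =>
    hasDerivAt_family_apply (c.hasFDerivAt_dChart (hγ t)) rfl (hd t).hasDerivAt hV.hasDerivAt
  constructor
  · rintro ⟨hs, hVd, he⟩
    refine ⟨hs, hVd, fun t => (hder t (hVd t)).congr_deriv (c.form_definite _ ?_)⟩
    set x := c.ddChart (γ t) (deriv γ t) (V t) + c.dChart (γ t) (deriv V t)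
    -- The test vector is the one whose coordinates are the covariant derivative `x` itself, so the
    -- equation becomes `form x x = 0`.
    have h := he t (c.equiv (c.chart (γ t)) x) (c.equiv (c.chart (γ t)) x).2
    rwa [c.covariant_eq (hγ t) (hγs t) (hs t) (isSymm_deriv hs (hVd t))
      (c.equiv (c.chart (γ t)) x).2, c.dChart_equiv (hγ t)] at h
  · rintro ⟨hs, hVd, h⟩
    refine ⟨hs, hVd, fun t W hW => ?_⟩
    rw [c.covariant_eq (hγ t) (hγs t) (hs t) (isSymm_deriv hs (hVd t)) hW,
      (hder t (hVd t)).unique (h t), map_zero, zero_apply]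

/-- The curve with affine coordinates `f + t x`. -/
noncomputable def line (f x : symSubmodule n) (t : ℝ) : Mat n := c.param (f + t • x)

theorem posDef_line (f x : symSubmodule n) (t : ℝ) : (c.line f x t).PosDef := c.posDef_param _

theorem hasDerivAt_affine (f x : symSubmodule n) (t : ℝ) :
    HasDerivAt (fun s : ℝ => f + s • x) x t := by
  simpa using ((hasDerivAt_id t).smul_const x).const_add f

theorem hasDerivAt_line (f x : symSubmodule n) (t : ℝ) :
    HasDerivAt (c.line f x) (c.equiv (f + t • x) x : Mat n) t := by
  have h := (c.contDiff_param.differentiable two_ne_zero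
    (f + t • x)).hasFDerivAt.comp_hasDerivAt t (hasDerivAt_affine f x t)
  rw [c.equiv_apply]
  exact (symSubmodule n).subtypeL.hasFDerivAt.comp_hasDerivAt t h

theorem chart_line (f x : symSubmodule n) (t : ℝ) : c.chart (c.line f x t) = f + t • x :=
  c.chart_param _

/-- The field has constant coordinates `y` along the line. -/
theorem isParallelAlong_line (f x y : symSubmodule n) :
    IsParallelAlong G (c.line f x) fun t => (c.equiv (f + t • x) y : Mat n) := by
  rw [c.isParallelAlong_iff (c.posDef_line f x)
    fun t => (c.hasDerivAt_line f x t).differentiableAt]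
  refine ⟨fun t => (c.equiv (f + t • x) y).2, fun t => ?_, fun t => ?_⟩
  · simp only [c.equiv_apply]
    have h1 : DifferentiableAt ℝ (fderiv ℝ c.param) (f + t • x) :=
      ((c.contDiff_param.fderiv_right (m := 1) (by norm_num)).differentiable one_ne_zero) _
    have h2 : DifferentiableAt ℝ (fun s : ℝ => fderiv ℝ c.param (f + s • x) y) t :=
      (h1.hasFDerivAt.comp_hasDerivAt t (hasDerivAt_affine f x t)).differentiableAt.clm_apply
        (differentiableAt_const y)
    exact (symSubmodule n).subtypeL.differentiableAt.comp t h2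
  · have : (fun s => c.dChart (c.line f x s) (c.equiv (f + s • x) y)) = fun _ => y := by
      ext1 s
      rw [← c.chart_line f x s, c.dChart_equiv (c.posDef_line f x s)]
    rw [this]
    exact hasDerivAt_const t y

theorem isGeodesic_line (f x : symSubmodule n) : IsGeodesic G (c.line f x) := by
  refine ⟨c.posDef_line f x, fun t => (c.hasDerivAt_line f x t).differentiableAt, ?_⟩
  rw [show deriv (c.line f x) = _ from funext fun t => (c.hasDerivAt_line f x t).deriv]
  exact c.isParallelAlong_line f x x

theorem dChart_eq_of_isParallelAlong {γ V : ℝ → Mat n} (hγ : IsGeodesic G γ)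
    (hV : IsParallelAlong G γ V) (t : ℝ) : c.dChart (γ t) (V t) = c.dChart (γ 0) (V 0) :=
  eq_of_hasDerivAt_zero ((c.isParallelAlong_iff hγ.posDef hγ.differentiable).1 hV).2.2 t

/-- The velocity is parallel, so its coordinates are constant and the geodesic is affine in the
chart. This is the uniqueness behind `expMap_eq`. -/
theorem chart_geodesic {γ : ℝ → Mat n} (hγ : IsGeodesic G γ) (t : ℝ) :
    c.chart (γ t) = c.chart (γ 0) + t • c.dChart (γ 0) (deriv γ 0) := by
  have h : ∀ t, HasDerivAt (fun t => c.chart (γ t) - t • c.dChart (γ 0) (deriv γ 0)) 0 t :=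
    fun t => by
      have h1 : HasDerivAt (fun t => c.chart (γ t)) (c.dChart (γ t) (deriv γ t)) t :=
        ((c.hasFDerivAt_chart (hγ.posDef t)).differentiableAt.hasFDerivAt).comp_hasDerivAt t
          (hγ.differentiable t).hasDerivAt
      refine (h1.sub ((hasDerivAt_id t).smul_const _)).congr_deriv ?_
      rw [c.dChart_eq_of_isParallelAlong hγ hγ.parallel t, one_smul, sub_self]
  have := eq_of_hasDerivAt_zero h t
  simp only [zero_smul, sub_zero] at this
  rw [← this, sub_add_cancel]

theorem expMap_eq (c : FlatChart G) {P W : Mat n} (hP : P.PosDef) (hW : W.IsSymm) :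
    expMap G P W = c.param (c.chart P + c.dChart P W) := by
  refine epsilon_eq_of_unique ⟨c.line (c.chart P) (c.dChart P W), c.isGeodesic_line _ _, ?_, ?_, ?_⟩
    ?_
  · rw [line, zero_smul, add_zero, c.param_chart hP]
  · rw [(c.hasDerivAt_line _ _ 0).deriv, zero_smul, add_zero, c.equiv_dChart hP hW]
  · rw [line, one_smul]
  · rintro Q ⟨γ, hγ, h0, h0', rfl⟩
    rw [← c.param_chart (hγ.posDef 1), c.chart_geodesic hγ 1, h0, h0', one_smul]

theorem posDef_expMap (c : FlatChart G) {P W : Mat n} (hP : P.PosDef) (hW : W.IsSymm) : (expMap G P W).PosDef := by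
  rw [c.expMap_eq hP hW]
  exact c.posDef_param _

theorem chart_expMap {P W : Mat n} (hP : P.PosDef) (hW : W.IsSymm) :
    c.chart (expMap G P W) = c.chart P + c.dChart P W := by
  rw [c.expMap_eq hP hW, c.chart_param]

/-- Existence of a preimage suffices: whatever vector is chosen, `chart_expMap` fixes its
coordinates. The same principle gives `transport_spec`. -/
theorem logMap_spec {P Q : Mat n} (hP : P.PosDef) (hQ : Q.PosDef) :
    (logMap G P Q).IsSymm ∧ c.dChart P (logMap G P Q) = c.chart Q - c.chart P := by
  have h : (logMap G P Q).IsSymm ∧ expMap G P (logMap G P Q) = Q := by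
    refine Classical.epsilon_spec (p := fun W : Mat n => W.IsSymm ∧ expMap G P W = Q)
      ⟨c.equiv (c.chart P) (c.chart Q - c.chart P), Subtype.prop _, ?_⟩
    rw [c.expMap_eq hP (c.equiv (c.chart P) (c.chart Q - c.chart P)).2, c.dChart_equiv hP, add_sub_cancel, c.param_chart hQ]
  refine ⟨h.1, ?_⟩
  rw [← h.2, c.chart_expMap hP h.1, h.2, add_sub_cancel_left]

theorem transport_spec {P Q W : Mat n} (hP : P.PosDef) (hQ : Q.PosDef) (hW : W.IsSymm) :
    (transport G P Q W).IsSymm ∧ c.dChart Q (transport G P Q W) = c.dChart P W := by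
  obtain ⟨γ, V, hγ, h0, h1, hV, hV0, hV1⟩ : ∃ γ V, IsGeodesic G γ ∧ γ 0 = P ∧ γ 1 = Q ∧
      IsParallelAlong G γ V ∧ V 0 = W ∧ V 1 = transport G P Q W := by
    refine Classical.epsilon_spec (p := fun X => ∃ γ V, IsGeodesic G γ ∧ γ 0 = P ∧ γ 1 = Q ∧
      IsParallelAlong G γ V ∧ V 0 = W ∧ V 1 = X) ⟨_, c.line (c.chart P) (c.chart Q - c.chart P),
      _, c.isGeodesic_line _ _, ?_, ?_, c.isParallelAlong_line _ _ (c.dChart P W), ?_, rfl⟩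
    · rw [line, zero_smul, add_zero, c.param_chart hP]
    · rw [line, one_smul, add_sub_cancel, c.param_chart hQ]
    · rw [zero_smul, add_zero, c.equiv_dChart hP hW]
  rw [← hV1]
  refine ⟨hV.isSymm 1, ?_⟩
  rw [← h1, c.dChart_eq_of_isParallelAlong hγ hV, h0, hV0]

/-- In a flat chart sending `1` to `0` and gyro-differences to differences, the two defining
functions of the hypergyroplane agree. -/
theorem hypergyroplane {P W Q R : Mat n} (hP : P.PosDef) (hW : W.IsSymm)
    (hQ : Q.PosDef) (hR : R.PosDef) (h1 : c.chart 1 = 0) (hRc : c.chart R = c.chart Q - c.chart P) :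
    G P (logMap G P Q) W =
      G 1 (logMap G 1 R) (logMap G 1 (expMap G 1 (transport G P 1 W))) := by
  have hI : (1 : Mat n).PosDef := Matrix.PosDef.one
  obtain ⟨hTs, hT⟩ := c.transport_spec hP hI hW
  obtain ⟨hLs, hL⟩ := c.logMap_spec hP hQ
  obtain ⟨hMs, hM⟩ := c.logMap_spec hI hR
  obtain ⟨hNs, hN⟩ := c.logMap_spec hI (c.posDef_expMap hI hTs)
  rw [c.metric_eq_form hP hLs hW, c.metric_eq_form hI hMs hNs, hL, hM, hN,
    c.chart_expMap hI hTs, hT, hRc, h1, sub_zero, zero_add, sub_zero]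

end FlatChart

/-- The derivative of a map to symmetric matrices along a line, read in matrices. -/
theorem hasDerivAt_coe_line {φ : symSubmodule n → symSubmodule n}
    {φ' : symSubmodule n →L[ℝ] symSubmodule n} {f : symSubmodule n} (h : HasFDerivAt φ φ' f)
    (x : symSubmodule n) : HasDerivAt (fun s : ℝ => (φ (f + s • x) : Mat n)) (φ' x) 0 := by
  have hl : HasDerivAt (fun s : ℝ => f + s • x) x 0 := by
    simpa using ((hasDerivAt_id (0 : ℝ)).smul_const x).const_add f
  have h0 : f + (0 : ℝ) • x = f := by rw [zero_smul, add_zero]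
  have h1 : HasFDerivAt φ φ' (f + (0 : ℝ) • x) := by rwa [h0]
  exact (symSubmodule n).subtypeL.hasFDerivAt.comp_hasDerivAt (0 : ℝ) (h1.comp_hasDerivAt (0 : ℝ) hl)

/-! ### The log-Euclidean geometry -/

/-- The exponential on symmetric matrices. -/
noncomputable def symExp (f : symSubmodule n) : symSubmodule n := ⟨exp (f : Mat n), f.2.exp⟩

/-- The logarithm on symmetric matrices. -/
noncomputable def symLog (p : symSubmodule n) : symSubmodule n :=
  ⟨matLog (p : Mat n), isSymm_matLog _⟩

/-- Smoothness into the subspace of symmetric matrices is obtained by composing with the projection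
`symPart`, which fixes the values. -/
theorem contDiff_symExp : ContDiff ℝ 2 (symExp (n := n)) := by
  have h : ContDiff ℝ 2 (exp : Mat n → Mat n) :=
    contDiff_iff_contDiffAt.2 fun x => (NormedSpace.exp_analytic (𝕂 := ℝ) x).contDiffAt
  have h2 := (symPart n).contDiff.comp (h.comp (symSubmodule n).subtypeL.contDiff)
  convert h2 using 1
  ext1 f
  exact (symPart_coe (symExp f)).symm

theorem symLog_symExp (f : symSubmodule n) : symLog (symExp f) = f :=
  Subtype.ext (matLog_exp f.2)

/-- Suppose the differential kills `x`. Differentiating `Y exp Y = exp Y Y` at `Y = f + s x` shows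
that `x` commutes with `exp f`, hence with its logarithm `f`. Then `exp (f + s x) = exp f exp (s x)`
has derivative `exp f x`, which must vanish, and `exp f` is invertible. -/
theorem injective_fderiv_symExp (f : symSubmodule n) :
    Function.Injective (fderiv ℝ (symExp (n := n)) f) := by
  refine (injective_iff_map_eq_zero _).2 fun x hx => ?_
  have h := hasDerivAt_coe_line
    (contDiff_symExp.differentiable two_ne_zero f).hasFDerivAt x
  rw [hx] at h
  have h' : HasDerivAt (fun s : ℝ => exp ((f : Mat n) + s • (x : Mat n))) 0 0 := h
  have hl := hasDerivAt_line (f : Mat n) (x : Mat n)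
  have hcomm : (fun s : ℝ => exp ((f : Mat n) + s • (x : Mat n))) *
      (fun s : ℝ => (f : Mat n) + s • (x : Mat n)) =
      (fun s : ℝ => (f : Mat n) + s • (x : Mat n)) *
      fun s : ℝ => exp ((f : Mat n) + s • (x : Mat n)) :=
    funext fun s => (Commute.refl _).exp_right.eq.symm
  have h1 := hl.mul h'
  have h2 := h'.mul hl
  have h3 := h1.unique (hcomm ▸ h2 :)
  simp only [zero_smul, add_zero, mul_zero, zero_mul, zero_add] at h3
  have hc : Commute (exp (f : Mat n)) (x : Mat n) := h3.symm
  have hfx : Commute (f : Mat n) (x : Mat n) := by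
    have := hc.cfc_real Real.log
    rwa [show cfc Real.log (exp (f : Mat n)) = f from matLog_exp f.2] at this
  have h4 : HasDerivAt (fun s : ℝ => exp ((f : Mat n) + s • (x : Mat n)))
      (exp (f : Mat n) * x) 0 := by
    have he : (fun s : ℝ => exp ((f : Mat n) + s • (x : Mat n))) =
        fun s => exp (f : Mat n) * exp (s • (x : Mat n)) :=
      funext fun s => Matrix.exp_add_of_commute _ _ (hfx.smul_right s)
    rw [he]
    simpa using (hasDerivAt_exp_smul_const (𝕂 := ℝ) (x : Mat n) 0).const_mul (exp (f : Mat n))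
  exact Subtype.ext (((isUnit_exp _).mul_right_eq_zero).1 (h4.unique h'))

/-- The inverse function theorem makes the differential of the logarithm the inverse of that of the
exponential. -/
theorem dLog_symExp (f x : symSubmodule n) :
    dLog (symExp f : Mat n) (fderiv ℝ symExp f x : Mat n) = x := by
  obtain ⟨e, he, hd, -⟩ := exists_equiv_inverse contDiff_symExp.contDiffAt
    (injective_fderiv_symExp f) symLog_symExp
  have h := hasDerivAt_coe_line hd (fderiv ℝ symExp f x)
  rw [← he] at h ⊢
  exact h.deriv.trans (congrArg Subtype.val (e.symm_apply_apply x))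

/-- The Frobenius inner product on symmetric matrices. -/
noncomputable def symTrace (n : ℕ) : symSubmodule n →L[ℝ] symSubmodule n →L[ℝ] ℝ :=
  LinearMap.toContinuousBilinearMap <| LinearMap.mk₂ ℝ
    (fun x y : symSubmodule n => ((x : Mat n) * (y : Mat n)).trace)
    (fun x x' y => by simp [Matrix.add_mul]) (fun c x y => by simp)
    (fun x y y' => by simp [Matrix.mul_add]) (fun c x y => by simp)

theorem symTrace_apply (x y : symSubmodule n) :
    symTrace n x y = ((x : Mat n) * (y : Mat n)).trace := rfl

/-- The matrix logarithm is a flat chart of the log-Euclidean metric. -/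
noncomputable def leChart (n : ℕ) : FlatChart (leMetric (n := n)) where
  param := symExp
  coord := symLog
  form := symTrace n
  contDiff_param := contDiff_symExp
  injective_fderiv := injective_fderiv_symExp
  posDef_param f := posDef_exp f.2
  coord_param := symLog_symExp
  param_coord p hp := Subtype.ext (exp_matLog hp)
  form_symm x y := by rw [symTrace_apply, symTrace_apply, Matrix.trace_mul_comm]
  form_definite x h := by
    rw [symTrace_apply] at h
    refine Subtype.ext (Matrix.trace_conjTranspose_mul_self_eq_zero_iff.1 ?_)
    rwa [Matrix.conjTranspose_eq_transpose_of_trivial, x.2]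
  metric_eq f x y := by rw [leMetric, dLog_symExp, dLog_symExp, symTrace_apply]

theorem leChart_chart {P : Mat n} (hP : P.IsSymm) : ((leChart n).chart P : Mat n) = matLog P := by
  change matLog (symPart n P : Mat n) = _
  rw [coe_symPart hP]

theorem hypergyroplane_le {P W Q : Mat n} (hP : P.PosDef) (hW : W.IsSymm) (hQ : Q.PosDef) :
    leMetric P (logMap leMetric P Q) W =
      (Geometry.le (n := n)).spdInner ((Geometry.le (n := n)).add ((Geometry.le (n := n)).neg P) Q)
      (expMap leMetric 1 (transport leMetric P 1 W)) := by
  have hs : (matLog P⁻¹ + matLog Q).IsSymm := (isSymm_matLog _).add (isSymm_matLog _)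
  have hR : (exp (matLog P⁻¹ + matLog Q)).PosDef := posDef_exp hs
  refine (leChart n).hypergyroplane hP hW hQ hR (Subtype.ext ?_) (Subtype.ext ?_)
  · rw [leChart_chart Matrix.isSymm_one, matLog_one, Submodule.coe_zero]
  · change ((leChart n).chart (exp (matLog P⁻¹ + matLog Q)) : Mat n) = _
    rw [Submodule.coe_sub, leChart_chart (isSymm_of_posDef hR),
      leChart_chart (isSymm_of_posDef hP),
      leChart_chart (isSymm_of_posDef hQ), matLog_exp hs, matLog_inv hP]
    abel

/-! ### The Cholesky decomposition -/

theorem isLowerTriangular_iff {M : Mat n} : M.IsLowerTriangular ↔ ∀ i j, i < j → M i j = 0 :=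
  Iff.rfl

theorem diag_ne_zero_of_isUnit {M : Mat n} (hM : M.IsLowerTriangular) (hu : IsUnit M) (i : Fin n) :
    M i i ≠ 0 := by
  rw [Matrix.isUnit_iff_isUnit_det, Matrix.det_of_isLowerTriangular M hM, isUnit_iff_ne_zero] at hu
  exact Finset.prod_ne_zero_iff.1 hu i (Finset.mem_univ i)

theorem isUnit_of_diag_pos {M : Mat n} (hM : M.IsLowerTriangular) (hd : ∀ i, 0 < M i i) :
    IsUnit M := by
  rw [Matrix.isUnit_iff_isUnit_det, Matrix.det_of_isLowerTriangular M hM, isUnit_iff_ne_zero]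
  exact (Finset.prod_pos fun i _ => hd i).ne'

theorem isLowerTriangular_inv {M : Mat n} (hM : M.IsLowerTriangular) (hu : IsUnit M) :
    M⁻¹.IsLowerTriangular := by
  have := hu.invertible
  exact Matrix.blockTriangular_inv_of_blockTriangular hM

theorem isLowerTriangular_diagonal (d : Fin n → ℝ) :
    (Matrix.diagonal d : Mat n).IsLowerTriangular :=
  Matrix.blockTriangular_diagonal d

theorem exists_isCholesky {P : Mat n} (hP : P.PosDef) : ∃ L, IsCholesky P L := by
  set K := LDL.lower hP with hK
  set d := LDL.diagEntries hP with hd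
  have hinv : (LDL.lowerInv hP).IsLowerTriangular := fun i j h => LDL.lowerInv_triangular hP h
  have hinvu : IsUnit (LDL.lowerInv hP) := isUnit_of_invertible _
  have hKl : K.IsLowerTriangular := isLowerTriangular_inv hinv hinvu
  have hKu : IsUnit K := Matrix.isUnit_nonsing_inv_iff.2 hinvu
  have hKd := diag_ne_zero_of_isUnit hKl hKu
  have hdpos : ∀ i, 0 < d i := by
    have h1 : (LDL.diag hP).PosDef := by
      rw [LDL.diag_eq_lowerInv_conj]
      have h2 := posDef_transpose_mul_mul hP ((Matrix.isUnit_transpose _).2 hinvu)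
      rwa [Matrix.transpose_transpose] at h2
    exact Matrix.posDef_diagonal_iff.1 h1
  -- Columns of the LDL factor are scaled by the square root of the pivot, times the sign of `K i i`
  -- to make the diagonal positive.
  set e : Fin n → ℝ := fun i => K i i / |K i i| * Real.sqrt (d i) with he
  have hee : ∀ i, e i * e i = d i := fun i => by
    have h1 : |K i i| ≠ 0 := abs_ne_zero.2 (hKd i)
    have h2 := Real.mul_self_sqrt (hdpos i).le
    have h3 := abs_mul_abs_self (K i i)
    simp only [he]
    field_simp
    rw [sq, sq, sq, h2, h3]
  refine ⟨K * Matrix.diagonal e, hKl.mul (isLowerTriangular_diagonal e), fun i => ?_, ?_⟩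
  · rw [Matrix.mul_diagonal]
    have h1 : K i i * e i = |K i i| * Real.sqrt (d i) := by
      have h2 := abs_ne_zero.2 (hKd i)
      have h3 := abs_mul_abs_self (K i i)
      simp only [he]
      field_simp
      rw [sq, sq, h3]
    rw [h1]
    exact mul_pos (abs_pos.2 (hKd i)) (Real.sqrt_pos.2 (hdpos i))
  · have h := LDL.lower_conj_diag hP
    rw [Matrix.conjTranspose_eq_transpose_of_trivial] at h
    rw [Matrix.transpose_mul, Matrix.diagonal_transpose, ← Matrix.mul_assoc,
      Matrix.mul_assoc K, Matrix.diagonal_mul_diagonal]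
    simp only [hee]
    exact h.symm

/-- `X = M⁻¹ L` is lower triangular and orthogonal. Its transpose is its inverse, so it is lower
triangular too and `X` is diagonal. Its entries are positive with square `1`. -/
theorem isCholesky_unique {P L M : Mat n} (hL : IsCholesky P L) (hM : IsCholesky P M) : L = M := by
  have hMu := isUnit_of_diag_pos hM.1 hM.2.1
  have hdet := (Matrix.isUnit_iff_isUnit_det M).1 hMu
  set X := M⁻¹ * L with hX
  have hLX : L = M * X := (Matrix.mul_nonsing_inv_cancel_left M L hdet).symm
  have hXl : X.IsLowerTriangular := (isLowerTriangular_inv hM.1 hMu).mul hL.1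
  have hXX : X * Xᵀ = 1 := by
    have h := hL.2.2.symm.trans hM.2.2
    rw [hX, Matrix.transpose_mul, Matrix.mul_assoc, ← Matrix.mul_assoc L, h, Matrix.mul_assoc M,
      Matrix.nonsing_inv_mul_cancel_left _ _ hdet, ← Matrix.transpose_mul,
      Matrix.nonsing_inv_mul _ hdet, Matrix.transpose_one]
  have hXu : IsUnit X := IsUnit.of_mul_eq_one _ hXX
  have hXt : Xᵀ.IsLowerTriangular := by
    rw [← Matrix.inv_eq_right_inv hXX]
    exact isLowerTriangular_inv hXl hXu
  have hXd : X = Matrix.diagonal fun i => X i i := by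
    ext i j
    rcases lt_trichotomy i j with h | h | h
    · rw [Matrix.diagonal_apply_ne _ h.ne]; exact hXl h
    · rw [h, Matrix.diagonal_apply_eq]
    · rw [Matrix.diagonal_apply_ne _ h.ne']; exact hXt h
  have hX1 : X = 1 := by
    rw [hXd, ← Matrix.diagonal_one]
    congr 1
    ext1 i
    have h1 : X i i * X i i = 1 := by
      have h := congrFun (congrFun hXX i) i
      rw [hXd, Matrix.diagonal_transpose, Matrix.diagonal_mul_diagonal] at h
      simpa using h
    have h2 : 0 < X i i := by
      have h := hL.2.1 i
      rw [hLX, hXd, Matrix.mul_diagonal] at h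
      exact (mul_pos_iff_of_pos_left (hM.2.1 i)).1 h
    nlinarith
  rw [hLX, hX1, mul_one]

theorem cholesky_spec {P : Mat n} (hP : P.PosDef) : IsCholesky P (cholesky P) :=
  Classical.epsilon_spec (exists_isCholesky hP)

theorem cholesky_mul_transpose {L : Mat n} (hl : L.IsLowerTriangular) (hd : ∀ i, 0 < L i i) :
    cholesky (L * Lᵀ) = L :=
  epsilon_eq_of_unique ⟨hl, hd, rfl⟩ fun _ h => isCholesky_unique h ⟨hl, hd, rfl⟩

theorem posDef_mul_transpose {L : Mat n} (hl : L.IsLowerTriangular) (hd : ∀ i, 0 < L i i) :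
    (L * Lᵀ).PosDef := by
  have h := posDef_transpose_mul_mul (Matrix.PosDef.one (n := Fin n) (R := ℝ))
    ((Matrix.isUnit_transpose L).2 (isUnit_of_diag_pos hl hd))
  rwa [Matrix.transpose_transpose, mul_one] at h

/-! ### The log-Cholesky geometry -/

theorem strictLower_apply (Y : Mat n) (i j : Fin n) :
    strictLower Y i j = if j < i then Y i j else 0 := rfl

theorem halfLower_apply (S : Mat n) (i j : Fin n) :
    halfLower S i j = (if j < i then S i j else 0) + if i = j then S i i / 2 else 0 := by
  rw [halfLower, Matrix.add_apply, strictLower_apply, Matrix.smul_apply, diagPart,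
    Matrix.diagonal_apply]
  split_ifs <;> simp <;> ring

/-- Symmetrizing doubles the diagonal, which the factor one half undoes. -/
theorem halfLower_add_transpose {X : Mat n} (hX : X.IsLowerTriangular) :
    halfLower (X + Xᵀ) = X := by
  ext i j
  rw [halfLower_apply]
  simp only [Matrix.add_apply, Matrix.transpose_apply]
  rcases lt_trichotomy i j with h | rfl | h
  · simp [h.not_gt, h.ne, isLowerTriangular_iff.1 hX i j h]
  · simp
  · simp [h, h.ne', isLowerTriangular_iff.1 hX j i h]

/-- Strictly lower part plus a diagonal. -/
theorem strictLower_add_diagonal_apply (Y : Mat n) (d : Fin n → ℝ) (i j : Fin n) :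
    (strictLower Y + Matrix.diagonal d) i j =
      if j < i then Y i j else if i = j then d i else 0 := by
  rw [Matrix.add_apply, strictLower_apply, Matrix.diagonal_apply]
  split_ifs with h1 h2 <;> simp_all

theorem isLowerTriangular_strictLower_add (Y : Mat n) (d : Fin n → ℝ) :
    (strictLower Y + Matrix.diagonal d).IsLowerTriangular :=
  isLowerTriangular_iff.2 fun i j h => by
    rw [strictLower_add_diagonal_apply]; simp [h.not_gt, h.ne]

theorem eq_strictLower_add_diagonal {L : Mat n} (hL : L.IsLowerTriangular) :
    L = strictLower L + Matrix.diagonal fun i => L i i := by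
  ext i j
  rw [strictLower_add_diagonal_apply]
  rcases lt_trichotomy i j with h | rfl | h
  · simp [h.not_gt, h.ne, isLowerTriangular_iff.1 hL i j h]
  · simp
  · simp [h]

/-- The lower triangular matrix with strictly lower part that of `f` and diagonal `exp (f i i)`. -/
noncomputable def lcFactor (f : Mat n) : Mat n :=
  strictLower f + Matrix.diagonal fun i => Real.exp (f i i)

theorem lcFactor_diag (f : Mat n) (i : Fin n) : lcFactor f i i = Real.exp (f i i) := by
  rw [lcFactor, strictLower_add_diagonal_apply]; simp

theorem isLowerTriangular_lcFactor (f : Mat n) : (lcFactor f).IsLowerTriangular :=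
  isLowerTriangular_strictLower_add _ _

theorem lcFactor_diag_pos (f : Mat n) (i : Fin n) : 0 < lcFactor f i i := by
  rw [lcFactor_diag]; exact Real.exp_pos _

/-- The symmetric matrix with lower triangular part `⌊L⌋ + log D(L)`. -/
noncomputable def lcCoord (L : Mat n) : symSubmodule n :=
  ⟨strictLower L + (strictLower L)ᵀ + Matrix.diagonal fun i => Real.log (L i i),
    (Matrix.isSymm_add_transpose_self _).add (Matrix.isSymm_diagonal _)⟩

theorem lcCoord_apply (L : Mat n) (i j : Fin n) : (lcCoord L : Mat n) i j =
    if j < i then L i j else if i < j then L j i else Real.log (L i i) := by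
  simp only [lcCoord, Matrix.add_apply, Matrix.transpose_apply, strictLower_apply,
    Matrix.diagonal_apply]
  rcases lt_trichotomy i j with h | rfl | h
  · simp [h, h.not_gt, h.ne]
  · simp
  · simp [h, h.not_gt, h.ne']

theorem lcFactor_lcCoord {L : Mat n} (hl : L.IsLowerTriangular) (hd : ∀ i, 0 < L i i) :
    lcFactor (lcCoord L : Mat n) = L := by
  conv_rhs => rw [eq_strictLower_add_diagonal hl]
  ext i j
  rw [lcFactor, strictLower_add_diagonal_apply, strictLower_add_diagonal_apply]
  split_ifs with h1 h2
  · rw [lcCoord_apply, if_pos h1]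
  · rw [lcCoord_apply]; simp [Real.exp_log (hd i)]
  · rfl

theorem lcCoord_lcFactor (f : symSubmodule n) : lcCoord (lcFactor (f : Mat n)) = f := by
  refine Subtype.ext (Matrix.ext fun i j => ?_)
  rw [lcCoord_apply, lcFactor_diag, Real.log_exp]
  simp only [lcFactor, strictLower_add_diagonal_apply]
  split_ifs with h1 h2
  · rfl
  · exact f.2.apply i j
  · rw [le_antisymm (not_lt.1 h1) (not_lt.1 h2)]

/-- The parametrization of positive definite matrices by log-Cholesky coordinates. -/
noncomputable def lcParam (f : symSubmodule n) : symSubmodule n :=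
  ⟨lcFactor (f : Mat n) * (lcFactor (f : Mat n))ᵀ, by
    change (_ * _)ᵀ = _
    rw [Matrix.transpose_mul, Matrix.transpose_transpose]⟩

theorem cholesky_lcParam (f : symSubmodule n) :
    cholesky (lcParam f : Mat n) = lcFactor (f : Mat n) :=
  cholesky_mul_transpose (isLowerTriangular_lcFactor _) (lcFactor_diag_pos _)

/-- `strictLower` as a linear map. -/
def strictLowerLinear (n : ℕ) : Mat n →ₗ[ℝ] Mat n where
  toFun := strictLower
  map_add' X Y := by ext i j; simp only [strictLower_apply, Matrix.add_apply]; split_ifs <;> simp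
  map_smul' c X := by
    ext i j; simp only [strictLower_apply, Matrix.smul_apply, RingHom.id_apply]; split_ifs <;> simp

theorem contDiff_lcFactor : ContDiff ℝ 2 (lcFactor (n := n)) := by
  have h1 : ContDiff ℝ 2 (strictLower (n := n)) :=
    (strictLowerLinear n).toContinuousLinearMap.contDiff
  have h2 : ContDiff ℝ 2 fun f : Mat n => fun i => Real.exp (f i i) :=
    contDiff_pi.2 fun i => Real.contDiff_exp.comp
      (Matrix.entryLinearMap ℝ ℝ i i).toContinuousLinearMap.contDiff
  have h3 : ContDiff ℝ 2 (Matrix.diagonalLinearMap (Fin n) ℝ ℝ) :=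
    (Matrix.diagonalLinearMap (Fin n) ℝ ℝ).toContinuousLinearMap.contDiff
  exact h1.add (h3.comp h2)

theorem contDiff_lcParam : ContDiff ℝ 2 (lcParam (n := n)) := by
  have h1 : ContDiff ℝ 2 fun f : symSubmodule n => lcFactor (f : Mat n) :=
    contDiff_lcFactor.comp (symSubmodule n).subtypeL.contDiff
  have h2 : ContDiff ℝ 2 fun f : symSubmodule n => (lcFactor (f : Mat n))ᵀ :=
    (Matrix.transposeLinearEquiv (Fin n) (Fin n) ℝ
      ℝ).toLinearMap.toContinuousLinearMap.contDiff.comp h1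
  have h3 := (symPart n).contDiff.comp (h1.mul h2)
  convert h3 using 1
  ext1 f
  exact (symPart_coe (lcParam f)).symm

/-- The derivative of `lcFactor` at `f` in the direction `x`. -/
noncomputable def dlcFactor (f x : Mat n) : Mat n :=
  strictLower x + Matrix.diagonal fun i => Real.exp (f i i) * x i i

theorem hasDerivAt_lcFactor (f x : Mat n) :
    HasDerivAt (fun s : ℝ => lcFactor (f + s • x)) (dlcFactor f x) 0 := by
  have hl := hasDerivAt_line f x
  have h1 := hasDerivAt_clm (strictLowerLinear n) hl
  have h2 : HasDerivAt (fun s : ℝ => fun i => Real.exp ((f + s • x) i i))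
      (fun i => Real.exp (f i i) * x i i) 0 :=
    hasDerivAt_pi.2 fun i => by
      simpa using (hasDerivAt_clm (Matrix.entryLinearMap ℝ ℝ i i) hl).exp
  have h3 := ((Matrix.diagonalLinearMap (Fin n) ℝ
    ℝ).toContinuousLinearMap.hasFDerivAt).comp_hasDerivAt (0 : ℝ) h2
  exact h1.add h3

theorem fderiv_lcParam (f x : symSubmodule n) : (fderiv ℝ lcParam f x : Mat n) =
    dlcFactor (f : Mat n) x * (lcFactor (f : Mat n))ᵀ +
      lcFactor (f : Mat n) * (dlcFactor (f : Mat n) (x : Mat n))ᵀ := by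
  have h := hasDerivAt_coe_line (contDiff_lcParam.differentiable two_ne_zero f).hasFDerivAt x
  have h1 := hasDerivAt_lcFactor (f : Mat n) x
  have h2 := h1.mul (hasDerivAt_transpose h1)
  have := h.unique h2
  simpa only [zero_smul, add_zero] using this

/-- The differential of the Cholesky map in terms of log-Cholesky coordinates. -/
theorem mul_halfLower_fderiv_lcParam (f x : symSubmodule n) :
    lcFactor (f : Mat n) * halfLower ((lcFactor (f : Mat n))⁻¹ * (fderiv ℝ lcParam f x : Mat n) *
      ((lcFactor (f : Mat n))⁻¹)ᵀ) = dlcFactor (f : Mat n) x := by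
  rw [fderiv_lcParam]
  set L := lcFactor (f : Mat n)
  set D := dlcFactor (f : Mat n) x
  have hLl : L.IsLowerTriangular := isLowerTriangular_lcFactor _
  have hu : IsUnit L := isUnit_of_diag_pos hLl (lcFactor_diag_pos _)
  have hdet := (Matrix.isUnit_iff_isUnit_det L).1 hu
  have hD : D.IsLowerTriangular := isLowerTriangular_strictLower_add _ _
  have hT : Lᵀ * (L⁻¹)ᵀ = 1 := by
    rw [← Matrix.transpose_mul, Matrix.nonsing_inv_mul _ hdet, Matrix.transpose_one]
  -- The congruence turns the product rule into `X + Xᵀ` with `X = L⁻¹ D` lower triangular, from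
  -- which `halfLower` recovers `X`.
  have h : L⁻¹ * (D * Lᵀ + L * Dᵀ) * (L⁻¹)ᵀ = L⁻¹ * D + (L⁻¹ * D)ᵀ := by
    rw [Matrix.mul_add, Matrix.add_mul, Matrix.nonsing_inv_mul_cancel_left _ _ hdet,
      Matrix.transpose_mul, ← Matrix.mul_assoc, Matrix.mul_assoc _ Lᵀ, hT, mul_one]
  rw [h, halfLower_add_transpose ((isLowerTriangular_inv hLl hu).mul hD),
    Matrix.mul_nonsing_inv_cancel_left _ _ hdet]

theorem dCholesky_fderiv_lcParam (f x : symSubmodule n) :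
    dCholesky (lcParam f : Mat n) (fderiv ℝ lcParam f x : Mat n) = dlcFactor (f : Mat n) x := by
  rw [dCholesky, cholesky_lcParam]
  exact mul_halfLower_fderiv_lcParam f x

theorem dlcFactor_apply (f x : Mat n) (i j : Fin n) : dlcFactor f x i j =
    if j < i then x i j else if i = j then Real.exp (f i i) * x i i else 0 :=
  strictLower_add_diagonal_apply _ _ _ _

theorem strictLower_dlcFactor (f x : Mat n) : strictLower (dlcFactor f x) = strictLower x := by
  ext i j
  rw [strictLower_apply, strictLower_apply, dlcFactor_apply]
  split_ifs <;> rfl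

theorem eq_zero_of_lower {x : symSubmodule n} (h1 : strictLower (x : Mat n) = 0)
    (h2 : ∀ i, (x : Mat n) i i = 0) : x = 0 := by
  have h : ∀ i j, j < i → (x : Mat n) i j = 0 := fun i j hij => by
    have := congrFun (congrFun h1 i) j
    rwa [strictLower_apply, if_pos hij] at this
  refine Subtype.ext (Matrix.ext fun i j => ?_)
  rcases lt_trichotomy i j with hij | rfl | hij
  · rw [← x.2.apply]; exact h j i hij
  · exact h2 i
  · exact h i j hij

/-- The differential of the Cholesky map recovers `dlcFactor`, which determines `x`: the strictly
lower part is unchanged and the diagonal is scaled by nonzero exponentials. -/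
theorem injective_fderiv_lcParam (f : symSubmodule n) :
    Function.Injective (fderiv ℝ (lcParam (n := n)) f) := by
  refine (injective_iff_map_eq_zero _).2 fun x hx => ?_
  have h := mul_halfLower_fderiv_lcParam f x
  have h0 : halfLower (0 : Mat n) = 0 := by
    ext i j; rw [halfLower_apply]; simp
  rw [hx, Submodule.coe_zero, mul_zero, zero_mul, h0, mul_zero] at h
  refine eq_zero_of_lower ?_ fun i => ?_
  · rw [← strictLower_dlcFactor (f : Mat n), ← h]
    exact map_zero (strictLowerLinear n)
  · have := congrFun (congrFun h i) i
    rw [dlcFactor_apply] at this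
    simpa using this.symm

/-- The inner product of lower triangular parts. -/
noncomputable def lcForm (n : ℕ) : symSubmodule n →L[ℝ] symSubmodule n →L[ℝ] ℝ :=
  LinearMap.toContinuousBilinearMap <| LinearMap.mk₂ ℝ
    (fun x y : symSubmodule n => (strictLowerLinear n x * (strictLowerLinear n y)ᵀ).trace +
      ∑ j, (x : Mat n) j j * (y : Mat n) j j)
    (fun x x' y => by
      simp only [Submodule.coe_add, map_add, Matrix.trace_add, Matrix.add_apply,
        add_mul, Finset.sum_add_distrib]
      ring)
    (fun c x y => by
      simp only [Submodule.coe_smul, map_smul, Matrix.smul_mul, Matrix.trace_smul,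
        Matrix.smul_apply, smul_eq_mul, mul_add, Finset.mul_sum, mul_assoc])
    (fun x y y' => by
      simp only [Submodule.coe_add, map_add, Matrix.transpose_add,
        Matrix.trace_add, Matrix.add_apply, mul_add, Finset.sum_add_distrib]
      ring)
    (fun c x y => by
      simp only [Submodule.coe_smul, map_smul, Matrix.transpose_smul, Matrix.mul_smul,
        Matrix.trace_smul, Matrix.smul_apply, smul_eq_mul, mul_add, Finset.mul_sum,
        mul_left_comm])

theorem lcForm_apply (x y : symSubmodule n) : lcForm n x y =
    (strictLower (x : Mat n) * (strictLower (y : Mat n))ᵀ).trace +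
      ∑ j, (x : Mat n) j j * (y : Mat n) j j := rfl

/-- Log-Cholesky coordinates are a flat chart of the log-Cholesky metric. -/
noncomputable def lcChart (n : ℕ) : FlatChart (lcMetric (n := n)) where
  param := lcParam
  coord p := lcCoord (cholesky (p : Mat n))
  form := lcForm n
  contDiff_param := contDiff_lcParam
  injective_fderiv := injective_fderiv_lcParam
  posDef_param f := posDef_mul_transpose (isLowerTriangular_lcFactor _) (lcFactor_diag_pos _)
  coord_param f := by rw [cholesky_lcParam, lcCoord_lcFactor]
  param_coord p hp := by
    obtain ⟨h1, h2, h3⟩ := cholesky_spec hp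
    refine Subtype.ext ?_
    change lcFactor (lcCoord (cholesky (p : Mat n)) : Mat n) *
      (lcFactor (lcCoord (cholesky (p : Mat n)) : Mat n))ᵀ = _
    rw [lcFactor_lcCoord h1 h2]
    exact h3.symm
  form_symm x y := by
    rw [lcForm_apply, lcForm_apply, ← Matrix.trace_transpose, Matrix.transpose_mul,
      Matrix.transpose_transpose]
    simp only [mul_comm]
  form_definite x h := by
    rw [lcForm_apply] at h
    have h1 : 0 ≤ (strictLower (x : Mat n) * (strictLower (x : Mat n))ᵀ).trace :=
      (Matrix.posSemidef_self_mul_conjTranspose _).trace_nonneg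
    have h2 : 0 ≤ ∑ j, (x : Mat n) j j * (x : Mat n) j j :=
      Finset.sum_nonneg fun j _ => mul_self_nonneg _
    have h3 : (strictLower (x : Mat n) * (strictLower (x : Mat n))ᵀ).trace = 0 := by linarith
    have h4 : ∑ j, (x : Mat n) j j * (x : Mat n) j j = 0 := by linarith
    refine eq_zero_of_lower (Matrix.trace_mul_conjTranspose_self_eq_zero_iff.1 h3) fun i => ?_
    exact mul_self_eq_zero.1
      ((Finset.sum_eq_zero_iff_of_nonneg fun j _ => mul_self_nonneg _).1 h4 i (Finset.mem_univ i))
  metric_eq f x y := by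
    rw [lcMetric, dCholesky_fderiv_lcParam, dCholesky_fderiv_lcParam, cholesky_lcParam,
      strictLower_dlcFactor, strictLower_dlcFactor, lcForm_apply]
    -- Each diagonal differential carries a factor `exp (f j j) = L j j`, and the two cancel the
    -- weight `1 / (L j j) ^ 2`.
    congr 1
    refine Finset.sum_congr rfl fun j _ => ?_
    rw [dlcFactor_apply, dlcFactor_apply, lcFactor_diag]
    have := (Real.exp_pos ((f : Mat n) j j)).ne'
    simp only [lt_irrefl, if_false, if_true]
    field_simp

theorem lcChart_chart {P : Mat n} (hP : P.IsSymm) :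
    (lcChart n).chart P = lcCoord (cholesky P) := by
  change lcCoord (cholesky (symPart n P : Mat n)) = _
  rw [coe_symPart hP]

theorem lcNegFactor_eq {P : Mat n} (hP : P.PosDef) : lcNegFactor P =
    strictLower (-cholesky P) + Matrix.diagonal fun i => (cholesky P i i)⁻¹ := by
  have h : diagPart (cholesky P) * (Matrix.diagonal fun i => (cholesky P i i)⁻¹) = 1 := by
    rw [diagPart, Matrix.diagonal_mul_diagonal, ← Matrix.diagonal_one]
    congr 1
    ext1 i
    exact mul_inv_cancel₀ ((cholesky_spec hP).2.1 i).ne'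
  rw [lcNegFactor, Matrix.inv_eq_right_inv h]
  congr 1
  exact (map_neg (strictLowerLinear n) _).symm

/-- The Cholesky factor of `⊖P ⊕ Q` has the difference of the strictly lower parts and the quotient
of the diagonals. Logarithms turn the quotient into a difference, so the coordinates subtract. -/
theorem hypergyroplane_lc {P W Q : Mat n} (hP : P.PosDef) (hW : W.IsSymm) (hQ : Q.PosDef) :
    lcMetric P (logMap lcMetric P Q) W =
      (Geometry.lc (n := n)).spdInner ((Geometry.lc (n := n)).add ((Geometry.lc (n := n)).neg P) Q)
      (expMap lcMetric 1 (transport lcMetric P 1 W)) := by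
  obtain ⟨hPl, hPd, -⟩ := cholesky_spec hP
  obtain ⟨hQl, hQd, -⟩ := cholesky_spec hQ
  have hneg : cholesky (lcNegFactor P * (lcNegFactor P)ᵀ) = lcNegFactor P := by
    rw [lcNegFactor_eq hP]
    refine cholesky_mul_transpose (isLowerTriangular_strictLower_add _ _) fun i => ?_
    rw [strictLower_add_diagonal_apply]
    simpa using hPd i
  set R := lcAddFactor (lcNegFactor P * (lcNegFactor P)ᵀ) Q with hRdef
  have hR : R = strictLower (cholesky Q - cholesky P) +
      Matrix.diagonal fun i => cholesky Q i i / cholesky P i i := by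
    rw [hRdef, lcAddFactor, hneg, lcNegFactor_eq hP, diagPart, diagPart,
      Matrix.diagonal_mul_diagonal]
    ext i j
    rw [strictLower_add_diagonal_apply]
    simp only [Matrix.add_apply, strictLower_apply, Matrix.diagonal_apply, Matrix.sub_apply,
      Matrix.neg_apply]
    rcases lt_trichotomy i j with h | rfl | h
    · simp [h.not_gt, h.ne]
    · simp only [lt_irrefl, if_false, if_true, zero_add]
      rw [mul_comm, div_eq_mul_inv]
    · simp [h, h.ne']
      ring
  have hRl : R.IsLowerTriangular := hR ▸ isLowerTriangular_strictLower_add _ _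
  have hRii : ∀ i, R i i = cholesky Q i i / cholesky P i i := fun i => by
    rw [hR, strictLower_add_diagonal_apply]; simp
  have hRd : ∀ i, 0 < R i i := fun i => by
    rw [hRii]; exact div_pos (hQd i) (hPd i)
  have hRpos : (R * Rᵀ).PosDef := posDef_mul_transpose hRl hRd
  have hRij : ∀ i j, j < i → R i j = cholesky Q i j - cholesky P i j := fun i j h => by
    rw [hR, strictLower_add_diagonal_apply, if_pos h, Matrix.sub_apply]
  refine (lcChart n).hypergyroplane hP hW hQ hRpos ?_ ?_
  · have h1 : cholesky (1 : Mat n) = 1 := by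
      have h := cholesky_mul_transpose (L := (1 : Mat n)) Matrix.blockTriangular_one
        fun i => by simp
      rwa [Matrix.transpose_one, mul_one] at h
    rw [lcChart_chart Matrix.isSymm_one, h1]
    refine Subtype.ext (Matrix.ext fun i j => ?_)
    rw [lcCoord_apply]
    split_ifs with h2 h3
    · exact Matrix.one_apply_ne h2.ne'
    · exact Matrix.one_apply_ne h3.ne'
    · simp
  · change (lcChart n).chart (R * Rᵀ) = _
    rw [lcChart_chart (isSymm_of_posDef hRpos), lcChart_chart (isSymm_of_posDef hP),
      lcChart_chart (isSymm_of_posDef hQ), cholesky_mul_transpose hRl hRd]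
    refine Subtype.ext (Matrix.ext fun i j => ?_)
    rw [Submodule.coe_sub, Matrix.sub_apply]
    simp only [lcCoord_apply]
    split_ifs with h1 h2
    · exact hRij i j h1
    · exact hRij j i h2
    · rw [hRii, Real.log_div (hQd i).ne' (hPd i).ne']

end SPDGyro

/-! ### The three geometries combined. -/

theorem proposition3p2 {n : ℕ} (g : SPDGyro.Geometry n) (P W : SPDGyro.Mat n)
    (hP : P.PosDef) (hW : W.IsSymm) :
    g.hypergyroplane W P =
      {Q | Q.PosDef ∧
        g.spdInner (g.add (g.neg P) Q)
          (SPDGyro.expMap g.metric 1 (SPDGyro.transport g.metric P 1 W)) = 0} := by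
  ext Q
  refine and_congr_right fun hQ => ?_
  cases g with
  | ai β hβ => exact (SPDGyro.hypergyroplane_ai hβ hP hW hQ) ▸ Iff.rfl
  | le => exact (SPDGyro.hypergyroplane_le hP hW hQ) ▸ Iff.rfl
  | lc => exact (SPDGyro.hypergyroplane_lc hP hW hQ) ▸ Iff.rfl
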